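/- Let $B,C,L>0$ and let $s_+=\frac{B+\sqrt{B^2+24|A|C}}{4C}$ with $A=-\frac{B^2}{3C}$ (so $s_+=B/C>0$). Let $\Omega=(-1,1)^2$. Throughout, a (bounded classical) solution on $\Omega$ is a bounded function on $\overline\Omega$ that is $C^2$ in $\Omega$, continuous on $\overline\Omega$ except possibly at the four corners, and satisfies the stated equation pointwise in $\Omega$ and the stated boundary conditions. For $\lambda\ge 0$ let $q$ be a solution of $\Delta q=\frac{2C\lambda^2}{L}q\big(q^2-\frac{B^2}{4C^2}\big)$ in $\Omega$ with $q=s_+/2$ on the open edges $y=\pm1$ and $q=-s_+/2$ on the open edges $x=\pm1$. The first-order corrections $(f,g,h)$ in the formal expansion $q_1=q+L_2f+\dots$, $q_2=L_2g+\dots$, $q_3=-\frac{s_+}{6}+L_2h+\dots$ as $L_2\to0$ are the solutions, vanishing on $\partial\Omega$, of $$\Delta f=\tfrac{C\lambda^2}{L}\Big(4q^2f+(2f-q)\big(q^2-\tfrac{B^2}{4C^2}\big)\Big),\qquad \Delta g=\tfrac{2C\lambda^2}{L}\,g\big(q^2-\tfrac{B^2}{4C^2}\big),$$ $$\Delta h=\tfrac{2C\lambda^2}{L}\,h\big(q^2+\tfrac{B^2}{4C^2}\big)-\tfrac16(q_{yy}-q_{xx}).$$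 **Proposition 4.1.** Let $\lambda=0$. The problem for $q$ has a solution $q_0$ (harmonic in $\Omega$), and for every such solution $q_0$ the following holds. 1. For every $(x,y)\in[-1,1]^2$ the double series $$h_0(x,y)=\sum_{m,n\ \mathrm{odd}}\frac{16\,s_+\,mn}{3\pi^2(m^2+n^2)^2} \sin\Big(\frac{m\pi(x+1)}{2}\Big)\sin\Big(\frac{n\pi(y+1)}{2}\Big)\qquad(m,n\ge1)$$ converges in the sense of rectangular partial sums, with the two truncation indices tending to infinity independently. 2. $h_0$ is the unique solution of $\Delta h_0=-\frac16(q_{0,yy}-q_{0,xx})$ in $\Omega$, $h_0=0$ on $\partial\Omega$; and $(f,g,h)=(0,0,h_0)$ is the unique triple of first-order corrections for $\lambda=0$. 3. $h_0(0,0)\ge \frac{s_+}{6}-\frac{s_+}{9}>0$. Hence the first-order approximation $-\frac{s_+}{6}+L_2h_0$ of $q_3$ at the centre of the square is larger than its value $-\frac{s_+}{6}$ at $L_2=0$, for every $L_2>0$. -/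

import Mathlib

open Filter Topology

noncomputable section

namespace NematicSquare

/-- The open square `(-1,1)²` with edges parallel to the coordinate axes. -/
def square : Set (ℝ × ℝ) := {p | |p.1| < 1 ∧ |p.2| < 1}

/-- The closed square `[-1,1]²`. -/
def closedSquare : Set (ℝ × ℝ) := {p | |p.1| ≤ 1 ∧ |p.2| ≤ 1}

/-- The boundary of the square (edges and corners). -/
def boundary : Set (ℝ × ℝ) := closedSquare \ square

/-- The four corners of the square. -/
def corners : Set (ℝ × ℝ) := {p | |p.1| = 1 ∧ |p.2| = 1}

/-- The second partial derivative `u_xx`. -/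
def dxx (u : ℝ × ℝ → ℝ) (p : ℝ × ℝ) : ℝ := iteratedDeriv 2 (fun t => u (t, p.2)) p.1

/-- The second partial derivative `u_yy`. -/
def dyy (u : ℝ × ℝ → ℝ) (p : ℝ × ℝ) : ℝ := iteratedDeriv 2 (fun t => u (p.1, t)) p.2

/-- The Laplacian `u_xx + u_yy`. -/
def lap (u : ℝ × ℝ → ℝ) (p : ℝ × ℝ) : ℝ := dxx u p + dyy u p

/-- The equilibrium scalar order parameter `s₊` for material constants `A < 0`, `B, C > 0`. -/
def sPlus (A B C : ℝ) : ℝ := (B + √(B ^ 2 + 24 * |A| * C)) / (4 * C)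

/-- `s₊` at the special temperature `A = -B² / (3 C)`. -/
def sStar (B C : ℝ) : ℝ := sPlus (-B ^ 2 / (3 * C)) B C

/-- The regularity of a bounded classical solution on the square: twice continuously
differentiable inside, bounded, and continuous up to the boundary except possibly at the corners,
where the tangent boundary data for `q₁` jump. -/
structure IsRegular (u : ℝ × ℝ → ℝ) : Prop where
  contDiffOn : ContDiffOn ℝ 2 u square
  continuousOn : ContinuousOn u (closedSquare \ corners)
  bounded : ∃ M : ℝ, ∀ p ∈ closedSquare, |u p| ≤ M

/-- The leading order profile of `q₁` as `L₂ → 0` (the `WORS`):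
`Δq = (2Cλ²/L) q (q² - B²/(4C²))` in the square, with `q = s₊/2` on the edges `y = ±1` and
`q = -s₊/2` on the edges `x = ±1`. -/
structure IsLeadingOrder (B C L lam : ℝ) (q : ℝ × ℝ → ℝ) : Prop where
  regular : IsRegular q
  pde : ∀ p ∈ square,
    lap q p = 2 * C * lam ^ 2 / L * (q p * (q p ^ 2 - B ^ 2 / (4 * C ^ 2)))
  horizontal : ∀ p : ℝ × ℝ, |p.1| < 1 → |p.2| = 1 → q p = sStar B C / 2
  vertical : ∀ p : ℝ × ℝ, |p.1| = 1 → |p.2| < 1 → q p = -sStar B C / 2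

/-- `(f, g, h)` are the first order corrections in the expansion
`q₁ = q + L₂ f + ⋯`, `q₂ = L₂ g + ⋯`, `q₃ = -B/(6C) + L₂ h + ⋯` of the solution of the
Euler-Lagrange system at `A = -B²/(3C)`: they solve the order `L₂` equations with zero
boundary values. -/
structure IsFirstOrderCorrection (B C L lam : ℝ) (q f g h : ℝ × ℝ → ℝ) : Prop where
  regular_f : IsRegular f
  regular_g : IsRegular g
  regular_h : IsRegular h
  pde_f : ∀ p ∈ square, lap f p = C * lam ^ 2 / L *
    (4 * q p ^ 2 * f p + (2 * f p - q p) * (q p ^ 2 - B ^ 2 / (4 * C ^ 2)))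
  pde_g : ∀ p ∈ square, lap g p = 2 * C * lam ^ 2 / L *
    (g p * (q p ^ 2 - B ^ 2 / (4 * C ^ 2)))
  pde_h : ∀ p ∈ square, lap h p = 2 * C * lam ^ 2 / L *
    (h p * (q p ^ 2 + B ^ 2 / (4 * C ^ 2))) - 1 / 6 * (dyy q p - dxx q p)
  zero_f : ∀ p ∈ boundary, f p = 0
  zero_g : ∀ p ∈ boundary, g p = 0
  zero_h : ∀ p ∈ boundary, h p = 0

/-- `h` solves `Δh = -(1/6) (q_yy - q_xx)` in the square with zero boundary values. -/
structure SolvesPoisson (q h : ℝ × ℝ → ℝ) : Prop where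
  regular : IsRegular h
  pde : ∀ p ∈ square, lap h p = -(1 / 6) * (dyy q p - dxx q p)
  zero : ∀ p ∈ boundary, h p = 0

/-- The term with indices `m, n` of the double sine series. -/
def sineTerm (s : ℝ) (m n : ℕ) (p : ℝ × ℝ) : ℝ :=
  16 * s * m * n / (3 * Real.pi ^ 2 * ((m : ℝ) ^ 2 + (n : ℝ) ^ 2) ^ 2) *
    Real.sin (m * Real.pi * (p.1 + 1) / 2) * Real.sin (n * Real.pi * (p.2 + 1) / 2)

/-- The rectangular partial sum over the first `M` odd `m` and the first `N` odd `n`. -/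
def sinePartialSum (s : ℝ) (M N : ℕ) (p : ℝ × ℝ) : ℝ :=
  ∑ i ∈ Finset.range M, ∑ j ∈ Finset.range N, sineTerm s (2 * i + 1) (2 * j + 1) p

/-- The double sine series `∑_{m,n odd}` has sum `a` at `p`: its rectangular partial sums tend to
`a` as both numbers of terms tend to infinity, independently of each other. The coefficients are
not absolutely summable, so an unordered sum would not make sense. -/
def HasSineSum (s : ℝ) (p : ℝ × ℝ) (a : ℝ) : Prop :=
  Tendsto (fun N : ℕ × ℕ => sinePartialSum s N.1 N.2 p) atTop (𝓝 a)

end NematicSquare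

end

/-! At `λ = 0` the reaction terms drop out: `f` and `g` are harmonic with zero boundary values, and
`h` solves a Poisson problem driven by `q`. Uniqueness throughout is a maximum principle
(`nonpos_of_lap_eq_zero`). Since the data of `q` jump at the corners, a small multiple of a
superharmonic barrier that blows up there is subtracted first.

Existence is explicit, on the strip `|y| < 1`. With `k = freq j`, the series `U = ∑ (2/k)
sin(k(x+1)) cosh(ky)/cosh k` is the real part of a holomorphic `F`, and `q = s (U - 1/2)`. For the
value at `y = 1`, the dominant exponential of each term is split off; these sum to `(2/π)
arg((1+z)/(1-z))`, and the remainder converges uniformly (`stripU_eq_edge`). Evenness in `y` covers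
`y = -1`.

Harmonicity of `q` turns the Poisson equation into `Δh = (s/3) U_xx`. Because `Δ(y Im F') = 2 Re F''
= 2 U_xx`, the function `(1/2) y Im F'` solves it up to the factor `s/3`. A harmonic sine series is
added so that every sine mode vanishes at `y = ±1`; the sum is `stripH`.

Continuity of `stripH` at `y = ±1` comes from a symmetry that its single series hides. Expanding
each mode in `y` (`hasSum_mode`) gives the coefficients `4kl/(k²+l²)²`, symmetric in `k` and `l`.
Summation by parts bounds the inner partial sums by a multiple of `k^(-3/2)`, so dominated
convergence yields the double series in the sense of rectangles (`tendsto_rectangular_sum`).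
Exchanging the indices shows `stripH(y,x) = stripH(x,y)`, and regularity at `x = ±1`, where the
single series is harmless, transfers to `y = ±1`.

At the centre the first term of the single series exceeds a geometric bound for the others by more
than `1/6`. -/

noncomputable section

namespace NematicSquare

/-! ### Second derivatives in one variable. -/

/-- `f` is twice continuously differentiable at `x`, with second derivative `d` there. -/
structure HasSecondDerivAt (f : ℝ → ℝ) (d x : ℝ) : Prop where
  contDiffAt : ContDiffAt ℝ 2 f x
  eq : iteratedDeriv 2 f x = d

namespace HasSecondDerivAt

variable {f g : ℝ → ℝ} {d e x : ℝ}

theorem add (hf : HasSecondDerivAt f d x) (hg : HasSecondDerivAt g e x) :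
    HasSecondDerivAt (fun t => f t + g t) (d + e) x := by
  refine ⟨hf.1.add hg.1, ?_⟩
  rw [← hf.2, ← hg.2]
  exact iteratedDeriv_add (n := 2) hf.1 hg.1

theorem sub (hf : HasSecondDerivAt f d x) (hg : HasSecondDerivAt g e x) :
    HasSecondDerivAt (fun t => f t - g t) (d - e) x := by
  refine ⟨hf.1.sub hg.1, ?_⟩
  rw [← hf.2, ← hg.2]
  exact iteratedDeriv_sub (n := 2) hf.1 hg.1

theorem of_hasDerivAt {f' : ℝ → ℝ} (hc : ContDiffAt ℝ 2 f x)
    (h : ∀ᶠ t in 𝓝 x, HasDerivAt f (f' t) t) (h' : HasDerivAt f' d x) :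
    HasSecondDerivAt f d x := by
  refine ⟨hc, ?_⟩
  rw [iteratedDeriv_succ, iteratedDeriv_one]
  have : deriv f =ᶠ[𝓝 x] f' := h.mono fun t ht => ht.deriv
  rw [this.deriv_eq, h'.deriv]

theorem const_mul (c : ℝ) (hf : HasSecondDerivAt f d x) :
    HasSecondDerivAt (fun t => c * f t) (c * d) x := by
  refine ⟨contDiffAt_const.mul hf.1, ?_⟩
  rw [← hf.2]
  exact iteratedDeriv_const_mul_field (n := 2) c f

theorem const (c : ℝ) : HasSecondDerivAt (fun _ => c) 0 x :=
  of_hasDerivAt (f' := fun _ => 0) contDiffAt_const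
    (Eventually.of_forall fun t => hasDerivAt_const t c) (hasDerivAt_const x 0)

theorem sq : HasSecondDerivAt (fun t => t ^ 2) 2 x := by
  refine of_hasDerivAt (f' := fun t => 2 * t) (by fun_prop)
    (Eventually.of_forall fun t => ?_) ?_
  · simpa using hasDerivAt_pow 2 t
  · simpa using (hasDerivAt_id x).const_mul 2

theorem log_sq_add {a c : ℝ} (h : 0 < (x - a) ^ 2 + c) :
    HasSecondDerivAt (fun t => Real.log ((t - a) ^ 2 + c))
      (2 * (c - (x - a) ^ 2) / ((x - a) ^ 2 + c) ^ 2) x := by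
  have hd : ∀ t : ℝ, HasDerivAt (fun t : ℝ => (t - a) ^ 2 + c) (2 * (t - a)) t := fun t => by
    simpa using (((hasDerivAt_id t).sub_const a).pow 2).add_const c
  have hev : ∀ᶠ t in 𝓝 x, 0 < (t - a) ^ 2 + c :=
    (show ContinuousAt (fun t : ℝ => (t - a) ^ 2 + c) x by fun_prop).eventually_const_lt h
  refine of_hasDerivAt (f' := fun t => 2 * (t - a) / ((t - a) ^ 2 + c)) ?_
    (hev.mono fun t ht => (hd t).log ht.ne') ?_
  · exact ContDiffAt.log (by fun_prop) h.ne'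
  · have := (((hasDerivAt_id x).sub_const a).const_mul 2).div (hd x) h.ne'
    exact this.congr_deriv (by simp only [id]; ring)

/-- A positive second derivative would make the maximum a local minimum as well, hence `f` locally
constant, hence the second derivative zero. -/
theorem nonpos_of_isLocalMax (hf : HasSecondDerivAt f d x) (hm : IsLocalMax f x) : d ≤ 0 := by
  by_contra! hd
  have h1 : deriv (deriv f) x = d := by
    rw [← hf.2, iteratedDeriv_succ, iteratedDeriv_one]
  have hmin := isLocalMin_of_deriv_deriv_pos (h1 ▸ hd) hm.deriv_eq_zero hf.1.continuousAt
  have hconst : f =ᶠ[𝓝 x] fun _ => f x := by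
    filter_upwards [hm, hmin] with t ht ht' using le_antisymm ht ht'
  have := hconst.iteratedDeriv_eq 2
  rw [hf.2, (const (f x)).2] at this
  exact hd.ne' this

end HasSecondDerivAt

/-! ### Topology of the square and partial derivatives along slices. -/

theorem isOpen_square : IsOpen square :=
  (isOpen_lt (f := fun p : ℝ × ℝ => |p.1|) (by fun_prop) continuous_const).inter
    (isOpen_lt (f := fun p : ℝ × ℝ => |p.2|) (by fun_prop) continuous_const)

theorem isClosed_closedSquare : IsClosed closedSquare :=
  (isClosed_le (f := fun p : ℝ × ℝ => |p.1|) (by fun_prop) continuous_const).inter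
    (isClosed_le (f := fun p : ℝ × ℝ => |p.2|) (by fun_prop) continuous_const)

theorem square_subset_closedSquare : square ⊆ closedSquare := fun _ hp => ⟨hp.1.le, hp.2.le⟩

theorem isCompact_closedSquare : IsCompact closedSquare := by
  refine Metric.isCompact_of_isClosed_isBounded isClosed_closedSquare ?_
  refine (Metric.isBounded_closedBall (x := (0 : ℝ × ℝ)) (r := 1)).subset fun p hp => ?_
  rw [mem_closedBall_zero_iff, Prod.norm_def]
  exact max_le hp.1 hp.2

theorem hasSecondDerivAt_dxx {u : ℝ × ℝ → ℝ} (hu : ContDiffOn ℝ 2 u square) {p : ℝ × ℝ}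
    (hp : p ∈ square) : HasSecondDerivAt (fun t => u (t, p.2)) (dxx u p) p.1 :=
  ⟨(hu.contDiffAt (isOpen_square.mem_nhds hp)).comp (f := fun t : ℝ => (t, p.2)) p.1
    (by fun_prop), rfl⟩

theorem hasSecondDerivAt_dyy {u : ℝ × ℝ → ℝ} (hu : ContDiffOn ℝ 2 u square) {p : ℝ × ℝ}
    (hp : p ∈ square) : HasSecondDerivAt (fun t => u (p.1, t)) (dyy u p) p.2 :=
  ⟨(hu.contDiffAt (isOpen_square.mem_nhds hp)).comp (f := fun t : ℝ => (p.1, t)) p.2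
    (by fun_prop), rfl⟩

theorem eventually_slice_fst {P : ℝ × ℝ → Prop} {p : ℝ × ℝ} (h : ∀ᶠ r in 𝓝 p, P r) :
    ∀ᶠ t in 𝓝 p.1, P (t, p.2) :=
  (show ContinuousAt (fun t : ℝ => (t, p.2)) p.1 by fun_prop).eventually h

theorem eventually_slice_snd {P : ℝ × ℝ → Prop} {p : ℝ × ℝ} (h : ∀ᶠ r in 𝓝 p, P r) :
    ∀ᶠ t in 𝓝 p.2, P (p.1, t) :=
  (show ContinuousAt (fun t : ℝ => (p.1, t)) p.2 by fun_prop).eventually h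

theorem dxx_congr {u v : ℝ × ℝ → ℝ} (h : Set.EqOn u v square) {p : ℝ × ℝ} (hp : p ∈ square) :
    dxx u p = dxx v p :=
  Filter.EventuallyEq.iteratedDeriv_eq 2 (eventually_slice_fst (P := fun r => u r = v r)
    (h.eventuallyEq_of_mem (isOpen_square.mem_nhds hp)))

theorem dyy_congr {u v : ℝ × ℝ → ℝ} (h : Set.EqOn u v square) {p : ℝ × ℝ} (hp : p ∈ square) :
    dyy u p = dyy v p :=
  Filter.EventuallyEq.iteratedDeriv_eq 2 (eventually_slice_snd (P := fun r => u r = v r)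
    (h.eventuallyEq_of_mem (isOpen_square.mem_nhds hp)))

theorem lap_congr {u v : ℝ × ℝ → ℝ} (h : Set.EqOn u v square) {p : ℝ × ℝ} (hp : p ∈ square) :
    lap u p = lap v p := by
  rw [lap, lap, dxx_congr h hp, dyy_congr h hp]

theorem lap_sub {u v : ℝ × ℝ → ℝ} (hu : ContDiffOn ℝ 2 u square) (hv : ContDiffOn ℝ 2 v square)
    {p : ℝ × ℝ} (hp : p ∈ square) : lap (fun r => u r - v r) p = lap u p - lap v p := by
  have h1 := ((hasSecondDerivAt_dxx hu hp).sub (hasSecondDerivAt_dxx hv hp)).eq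
  have h2 := ((hasSecondDerivAt_dyy hu hp).sub (hasSecondDerivAt_dyy hv hp)).eq
  rw [lap, dxx, dyy, h1, h2, lap, lap]
  ring

/-! ### The corner barrier and the maximum principle. -/

/-- The logarithmic potential of the point `(a, b)`, normalised to be nonnegative on the square
when `(a, b)` is a corner. -/
def logPotential (a b : ℝ) (p : ℝ × ℝ) : ℝ :=
  Real.log 8 - Real.log ((p.1 - a) ^ 2 + (p.2 - b) ^ 2)

theorem logPotential_nonneg {a b : ℝ} (ha : |a| ≤ 1) (hb : |b| ≤ 1) {p : ℝ × ℝ}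
    (hp : p ∈ closedSquare) : 0 ≤ logPotential a b p := by
  obtain ⟨h1, h2⟩ := hp
  rw [abs_le] at ha hb h1 h2
  rcases eq_or_lt_of_le (show 0 ≤ (p.1 - a) ^ 2 + (p.2 - b) ^ 2 by positivity) with h | h
  -- At the pole itself `Real.log 0 = 0`, so the value is `log 8` rather than infinity. Elsewhere
  -- `8` is the squared diameter of the square.
  · rw [logPotential, ← h, Real.log_zero, sub_zero]
    exact Real.log_nonneg (by norm_num)
  · refine sub_nonneg.2 (Real.log_le_log h ?_)
    nlinarith

/-- The opposite signs `d` and `-d` express harmonicity away from the pole. -/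
theorem hasSecondDerivAt_logPotential {a b : ℝ} {p : ℝ × ℝ}
    (h : 0 < (p.1 - a) ^ 2 + (p.2 - b) ^ 2) :
    ∃ d, HasSecondDerivAt (fun t => logPotential a b (t, p.2)) d p.1 ∧
      HasSecondDerivAt (fun t => logPotential a b (p.1, t)) (-d) p.2 := by
  refine ⟨0 - 2 * ((p.2 - b) ^ 2 - (p.1 - a) ^ 2) / ((p.1 - a) ^ 2 + (p.2 - b) ^ 2) ^ 2,
    (HasSecondDerivAt.const _).sub (HasSecondDerivAt.log_sq_add h), ?_⟩
  have h2 := (HasSecondDerivAt.const (Real.log 8)).sub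
    (HasSecondDerivAt.log_sq_add (a := b) (c := (p.1 - a) ^ 2) (x := p.2) (by linarith))
  convert h2 using 1
  · ext t
    simp only [logPotential, add_comm]
  · rw [add_comm ((p.2 - b) ^ 2)]
    ring

/-- A positive function on the square whose Laplacian is `-4` and which is infinite at the
corners. -/
def barrier (p : ℝ × ℝ) : ℝ :=
  logPotential 1 1 p + logPotential 1 (-1) p + logPotential (-1) 1 p + logPotential (-1) (-1) p +
    (2 - (p.1 ^ 2 + p.2 ^ 2))

theorem sq_add_sq_pos_of_mem_square {a b : ℝ} (ha : |a| = 1) {p : ℝ × ℝ} (hp : p ∈ square) :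
    0 < (p.1 - a) ^ 2 + (p.2 - b) ^ 2 := by
  have : p.1 - a ≠ 0 := fun h => by
    have := hp.1
    rw [sub_eq_zero.1 h, ha] at this
    exact lt_irrefl _ this
  positivity

theorem hasSecondDerivAt_barrier {p : ℝ × ℝ} (hp : p ∈ square) :
    ∃ d, HasSecondDerivAt (fun t => barrier (t, p.2)) d p.1 ∧
      HasSecondDerivAt (fun t => barrier (p.1, t)) (-4 - d) p.2 := by
  have h (a b : ℝ) (ha : |a| = 1) :=
    hasSecondDerivAt_logPotential (sq_add_sq_pos_of_mem_square (a := a) (b := b) ha hp)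
  obtain ⟨d1, h1, h1'⟩ := h 1 1 (by simp)
  obtain ⟨d2, h2, h2'⟩ := h 1 (-1) (by simp)
  obtain ⟨d3, h3, h3'⟩ := h (-1) 1 (by simp)
  obtain ⟨d4, h4, h4'⟩ := h (-1) (-1) (by simp)
  have e1 := (((h1.add h2).add h3).add h4).add ((HasSecondDerivAt.const 2).sub
    (HasSecondDerivAt.sq.add (HasSecondDerivAt.const (p.2 ^ 2))))
  have e2 := (((h1'.add h2').add h3').add h4').add ((HasSecondDerivAt.const 2).sub
    ((HasSecondDerivAt.const (p.1 ^ 2)).add HasSecondDerivAt.sq))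
  refine ⟨_, e1, ?_⟩
  convert e2 using 1
  · rfl
  · ring

theorem logPotential_le_barrier {a b : ℝ} (hab : (a, b) ∈ corners) {p : ℝ × ℝ}
    (hp : p ∈ closedSquare) : logPotential a b p ≤ barrier p := by
  have h1 := logPotential_nonneg (a := 1) (b := 1) (by simp) (by simp) hp
  have h2 := logPotential_nonneg (a := 1) (b := -1) (by simp) (by simp) hp
  have h3 := logPotential_nonneg (a := -1) (b := 1) (by simp) (by simp) hp
  have h4 := logPotential_nonneg (a := -1) (b := -1) (by simp) (by simp) hp
  have h5 : p.1 ^ 2 ≤ 1 := (sq_le_one_iff_abs_le_one _).2 hp.1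
  have h6 : p.2 ^ 2 ≤ 1 := (sq_le_one_iff_abs_le_one _).2 hp.2
  rw [barrier]
  obtain ⟨ha, hb⟩ := hab
  rcases (abs_eq zero_le_one).1 ha with rfl | rfl <;>
    rcases (abs_eq zero_le_one).1 hb with rfl | rfl <;> linarith

theorem barrier_nonneg {p : ℝ × ℝ} (hp : p ∈ closedSquare) : 0 ≤ barrier p :=
  (logPotential_nonneg (a := 1) (b := 1) (by simp) (by simp) hp).trans
    (logPotential_le_barrier (by simp [corners]) hp)

theorem continuousOn_barrier : ContinuousOn barrier (closedSquare \ corners) := by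
  have h (a b : ℝ) (hab : (a, b) ∈ corners) :
      ContinuousOn (logPotential a b) (closedSquare \ corners) := by
    refine continuousOn_const.sub (ContinuousOn.log (by fun_prop) fun p hp h0 => hp.2 ?_)
    have e1 : p.1 = a := by nlinarith [sq_nonneg (p.1 - a), sq_nonneg (p.2 - b)]
    have e2 : p.2 = b := by nlinarith [sq_nonneg (p.1 - a), sq_nonneg (p.2 - b)]
    rw [← Prod.mk.eta (p := p), e1, e2]
    exact hab
  exact ((((h 1 1 (by simp [corners])).add (h 1 (-1) (by simp [corners]))).add
    (h (-1) 1 (by simp [corners]))).add (h (-1) (-1) (by simp [corners]))).add (by fun_prop)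

theorem exists_le_logPotential (T : ℝ) : ∃ δ > 0, ∀ a b : ℝ, ∀ p : ℝ × ℝ,
    0 < (p.1 - a) ^ 2 + (p.2 - b) ^ 2 → (p.1 - a) ^ 2 + (p.2 - b) ^ 2 < δ →
      T ≤ logPotential a b p := by
  refine ⟨Real.exp (Real.log 8 - T), Real.exp_pos _, fun a b p h0 h => ?_⟩
  have := Real.log_lt_log h0 h
  rw [Real.log_exp] at this
  rw [logPotential]
  linarith

/-- One half of the maximum principle for bounded functions that vanish on the open edges. -/
theorem nonpos_of_lap_eq_zero {w : ℝ × ℝ → ℝ} (hw : IsRegular w) (hlap : ∀ p ∈ square, lap w p = 0)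
    (hzero : ∀ p ∈ boundary \ corners, w p = 0) : ∀ p ∈ square, w p ≤ 0 := by
  obtain ⟨M, hM⟩ := hw.bounded
  have key : ∀ ε > 0, ∀ p ∈ square, w p - ε * barrier p ≤ 0 := by
    intro ε hε p₀ hp₀
    by_contra! hpos
    obtain ⟨δ, hδ, hδ'⟩ := exists_le_logPotential (M / ε)
    -- Discs around the corners are removed, so small that inside them `ε * barrier` already exceeds
    -- the bound `M` of `w`. On the compact rest the function is continuous and attains its maximum.
    set K : Set (ℝ × ℝ) := closedSquare ∩ {p | ∀ c ∈ corners,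
      δ ≤ (p.1 - c.1) ^ 2 + (p.2 - c.2) ^ 2} with hK
    have hKc : IsCompact K := by
      refine isCompact_closedSquare.inter_right ?_
      simp only [Set.ofPred_forall]
      exact isClosed_iInter fun c => isClosed_iInter fun _ =>
        isClosed_le continuous_const (by fun_prop)
    have hKs : K ⊆ closedSquare \ corners := fun p hp => ⟨hp.1, fun hc => by
      have := hp.2 p hc
      simp only [sub_self] at this
      linarith⟩
    have hout : ∀ p ∈ square, p ∉ K → w p - ε * barrier p ≤ 0 := by
      intro p hp hpK
      have hpc := square_subset_closedSquare hp
      have : ∃ c ∈ corners, (p.1 - c.1) ^ 2 + (p.2 - c.2) ^ 2 < δ := by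
        by_contra! h
        exact hpK ⟨hpc, h⟩
      obtain ⟨c, hc, hcδ⟩ := this
      have h1 := hδ' c.1 c.2 p (sq_add_sq_pos_of_mem_square hc.1 hp) hcδ
      have h2 := (div_le_iff₀' hε).1 (h1.trans (logPotential_le_barrier hc hpc))
      have h3 := (abs_le.1 (hM p hpc)).2
      linarith
    have hp₀K : p₀ ∈ K := by
      by_contra h
      exact hpos.not_ge (hout p₀ hp₀ h)
    have hcont : ContinuousOn (fun p => w p - ε * barrier p) K :=
      (hw.continuousOn.sub (continuousOn_const.mul continuousOn_barrier)).mono hKs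
    obtain ⟨p₁, hp₁, hmax⟩ := hKc.exists_isMaxOn ⟨p₀, hp₀K⟩ hcont
    have hpos₁ : 0 < w p₁ - ε * barrier p₁ := hpos.trans_le (hmax hp₀K)
    have hp₁s : p₁ ∈ square := by
      by_contra h
      have h1 := hzero p₁ ⟨⟨hp₁.1, h⟩, (hKs hp₁).2⟩
      have h2 := mul_nonneg hε.le (barrier_nonneg hp₁.1)
      linarith
    have hloc : ∀ᶠ p in 𝓝 p₁, w p - ε * barrier p ≤ w p₁ - ε * barrier p₁ := by
      filter_upwards [isOpen_square.mem_nhds hp₁s] with p hp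
      by_cases hpK : p ∈ K
      · exact hmax hpK
      · exact (hout p hp hpK).trans hpos₁.le
    obtain ⟨d, hd, hd'⟩ := hasSecondDerivAt_barrier hp₁s
    have h1 := ((hasSecondDerivAt_dxx hw.contDiffOn hp₁s).sub
      (hd.const_mul ε)).nonpos_of_isLocalMax (eventually_slice_fst hloc)
    have h2 := ((hasSecondDerivAt_dyy hw.contDiffOn hp₁s).sub
      (hd'.const_mul ε)).nonpos_of_isLocalMax (eventually_slice_snd hloc)
    -- At an interior maximum both second derivatives are nonpositive, but they add up to `4 * ε`.
    have h3 := hlap p₁ hp₁s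
    rw [lap] at h3
    nlinarith
  intro p hp
  have ht : Tendsto (fun ε : ℝ => w p - ε * barrier p) (𝓝[>] 0) (𝓝 (w p - 0 * barrier p)) :=
    ((continuous_const.sub (continuous_id.mul continuous_const)).tendsto _).mono_left
      nhdsWithin_le_nhds
  have := le_of_tendsto ht (eventually_mem_nhdsWithin.mono fun ε hε => key ε hε p hp)
  simpa using this

theorem IsRegular.sub {u v : ℝ × ℝ → ℝ} (hu : IsRegular u) (hv : IsRegular v) :
    IsRegular fun p => u p - v p := by
  refine ⟨hu.1.sub hv.1, hu.2.sub hv.2, ?_⟩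
  obtain ⟨M, hM⟩ := hu.3
  obtain ⟨N, hN⟩ := hv.3
  exact ⟨M + N, fun p hp => (abs_sub _ _).trans (add_le_add (hM p hp) (hN p hp))⟩

theorem isRegular_const (c : ℝ) : IsRegular fun _ => c :=
  ⟨contDiffOn_const, continuousOn_const, |c|, fun _ _ => le_rfl⟩

theorem IsRegular.congr {u v : ℝ × ℝ → ℝ} (hu : IsRegular u) (h : Set.EqOn v u closedSquare) :
    IsRegular v := by
  refine ⟨hu.1.congr fun p hp => h (square_subset_closedSquare hp),
    hu.2.congr fun p hp => h hp.1, ?_⟩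
  obtain ⟨M, hM⟩ := hu.3
  exact ⟨M, fun p hp => by rw [h hp]; exact hM p hp⟩

/-- Bounded classical solutions of the Poisson equation are determined by their values on the open
edges. -/
theorem eqOn_square_of_lap_eq {u v : ℝ × ℝ → ℝ} (hu : IsRegular u) (hv : IsRegular v)
    (hlap : ∀ p ∈ square, lap u p = lap v p) (hb : ∀ p ∈ boundary \ corners, u p = v p) :
    Set.EqOn u v square := by
  intro p hp
  refine le_antisymm ?_ ?_
  · refine sub_nonpos.1 (nonpos_of_lap_eq_zero (hu.sub hv) (fun r hr => ?_) (fun r hr => ?_) p hp)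
    · rw [lap_sub hu.1 hv.1 hr, hlap r hr, sub_self]
    · rw [hb r hr, sub_self]
  · refine sub_nonpos.1 (nonpos_of_lap_eq_zero (hv.sub hu) (fun r hr => ?_) (fun r hr => ?_) p hp)
    · rw [lap_sub hv.1 hu.1 hr, hlap r hr, sub_self]
    · rw [hb r hr, sub_self]

theorem lap_const (c : ℝ) (p : ℝ × ℝ) : lap (fun _ => c) p = 0 := by
  rw [lap, dxx, dyy, (HasSecondDerivAt.const c).2, (HasSecondDerivAt.const c).2, add_zero]

/-! ### Harmonic functions from holomorphic functions on the strip. -/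

/-- The open strip `|Im z| < 1`. -/
def strip : Set ℂ := {z | |z.im| < 1}

theorem isOpen_strip : IsOpen strip :=
  isOpen_lt (f := fun z : ℂ => |z.im|) (Complex.continuous_im.abs) continuous_const

/-- The point of the complex plane with coordinates `p`. -/
def toComplex (p : ℝ × ℝ) : ℂ := p.1 + p.2 * Complex.I

@[simp] theorem toComplex_re (p : ℝ × ℝ) : (toComplex p).re = p.1 := by simp [toComplex]

@[simp] theorem toComplex_im (p : ℝ × ℝ) : (toComplex p).im = p.2 := by simp [toComplex]

theorem toComplex_mem_strip {p : ℝ × ℝ} (hp : |p.2| < 1) : toComplex p ∈ strip := by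
  simpa [strip] using hp

theorem contDiff_toComplex {n : WithTop ℕ∞} : ContDiff ℝ n toComplex := by
  unfold toComplex
  exact (Complex.ofRealCLM.contDiff.comp contDiff_fst).add
    ((Complex.ofRealCLM.contDiff.comp contDiff_snd).mul contDiff_const)

section Holomorphic

variable {F : ℂ → ℂ} {F' : ℂ} {x y : ℝ}

theorem hasDerivAt_horizontal (h : HasDerivAt F F' (toComplex (x, y))) :
    HasDerivAt (fun t : ℝ => F (toComplex (t, y))) F' x := by
  have h1 : HasDerivAt (fun t : ℝ => toComplex (t, y)) 1 x := by
    simpa [toComplex] using ((hasDerivAt_id x).ofReal_comp).add_const ((y : ℂ) * Complex.I)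
  exact (h.comp (h₂ := F) x h1).congr_deriv (mul_one _)

theorem hasDerivAt_vertical (h : HasDerivAt F F' (toComplex (x, y))) :
    HasDerivAt (fun t : ℝ => F (toComplex (x, t))) (F' * Complex.I) y := by
  have h1 : HasDerivAt (fun t : ℝ => toComplex (x, t)) Complex.I y := by
    simpa [toComplex] using
      (((hasDerivAt_id y).ofReal_comp).mul_const Complex.I).const_add (x : ℂ)
  exact h.comp (h₂ := F) y h1

theorem HasDerivAt.complex_re {f : ℝ → ℂ} {f' : ℂ} {t : ℝ} (h : HasDerivAt f f' t) :
    HasDerivAt (fun t => (f t).re) f'.re t :=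
  Complex.reCLM.hasFDerivAt.comp_hasDerivAt t h

theorem HasDerivAt.complex_im {f : ℝ → ℂ} {f' : ℂ} {t : ℝ} (h : HasDerivAt f f' t) :
    HasDerivAt (fun t => (f t).im) f'.im t :=
  Complex.imCLM.hasFDerivAt.comp_hasDerivAt t h

theorem contDiffOn_comp_toComplex (hF : DifferentiableOn ℂ F strip) :
    ContDiffOn ℝ 2 (fun p => F (toComplex p)) {p : ℝ × ℝ | |p.2| < 1} :=
  ((hF.contDiffOn isOpen_strip).restrict_scalars ℝ).comp contDiff_toComplex.contDiffOn
    fun _ hp => toComplex_mem_strip hp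

theorem contDiffOn_re (hF : DifferentiableOn ℂ F strip) :
    ContDiffOn ℝ 2 (fun p => (F (toComplex p)).re) {p : ℝ × ℝ | |p.2| < 1} :=
  Complex.reCLM.contDiff.comp_contDiffOn (contDiffOn_comp_toComplex hF)

theorem contDiffOn_im (hF : DifferentiableOn ℂ F strip) :
    ContDiffOn ℝ 2 (fun p => (F (toComplex p)).im) {p : ℝ × ℝ | |p.2| < 1} :=
  Complex.imCLM.contDiff.comp_contDiffOn (contDiffOn_comp_toComplex hF)

theorem square_subset_horizontal_strip : square ⊆ {p : ℝ × ℝ | |p.2| < 1} := fun _ hp => hp.2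

theorem hasDerivAt_of_mem_strip (hF : DifferentiableOn ℂ F strip) {z : ℂ} (hz : z ∈ strip) :
    HasDerivAt F (deriv F z) z :=
  (hF.differentiableAt (isOpen_strip.mem_nhds hz)).hasDerivAt

theorem eventually_toComplex_mem_strip {p : ℝ × ℝ} (hp : p ∈ square) :
    ∀ᶠ r in 𝓝 p, toComplex r ∈ strip :=
  (show ∀ᶠ r in 𝓝 p, r ∈ square from isOpen_square.mem_nhds hp).mono
    fun _ hr => toComplex_mem_strip hr.2

theorem dxx_re (hF : DifferentiableOn ℂ F strip) {p : ℝ × ℝ} (hp : p ∈ square) :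
    dxx (fun r => (F (toComplex r)).re) p = (deriv (deriv F) (toComplex p)).re := by
  refine (HasSecondDerivAt.of_hasDerivAt (f' := fun t => (deriv F (toComplex (t, p.2))).re)
    (hasSecondDerivAt_dxx ((contDiffOn_re hF).mono square_subset_horizontal_strip) hp).1 ?_ ?_).2
  · filter_upwards [eventually_slice_fst (eventually_toComplex_mem_strip hp)] with t ht
    exact HasDerivAt.complex_re (hasDerivAt_horizontal (hasDerivAt_of_mem_strip hF ht))
  · exact HasDerivAt.complex_re (hasDerivAt_horizontal
      (hasDerivAt_of_mem_strip (hF.deriv isOpen_strip) (toComplex_mem_strip hp.2)))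

theorem dyy_re (hF : DifferentiableOn ℂ F strip) {p : ℝ × ℝ} (hp : p ∈ square) :
    dyy (fun r => (F (toComplex r)).re) p = -(deriv (deriv F) (toComplex p)).re := by
  refine (HasSecondDerivAt.of_hasDerivAt
    (f' := fun t => (deriv F (toComplex (p.1, t)) * Complex.I).re)
    (hasSecondDerivAt_dyy ((contDiffOn_re hF).mono square_subset_horizontal_strip) hp).1 ?_ ?_).2
  · filter_upwards [eventually_slice_snd (eventually_toComplex_mem_strip hp)] with t ht
    exact HasDerivAt.complex_re (hasDerivAt_vertical (hasDerivAt_of_mem_strip hF ht))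
  · have := HasDerivAt.complex_re ((hasDerivAt_vertical (hasDerivAt_of_mem_strip
      (hF.deriv isOpen_strip) (toComplex_mem_strip hp.2))).mul_const Complex.I)
    exact this.congr_deriv (by simp)

theorem contDiffOn_mul_im (hF : DifferentiableOn ℂ F strip) :
    ContDiffOn ℝ 2 (fun p => p.2 * (F (toComplex p)).im) {p : ℝ × ℝ | |p.2| < 1} :=
  contDiff_snd.contDiffOn.mul (contDiffOn_im hF)

/-- By the product rule only the cross term `2 ∂_y Im F` survives, and `∂_y Im F = Re F'` by
Cauchy–Riemann. Applied to a derivative, this produces a particular solution of the Poisson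
equation. -/
theorem lap_mul_im (hF : DifferentiableOn ℂ F strip) {p : ℝ × ℝ} (hp : p ∈ square) :
    lap (fun r => r.2 * (F (toComplex r)).im) p = 2 * (deriv F (toComplex p)).re := by
  have hc := (contDiffOn_mul_im hF).mono square_subset_horizontal_strip
  have hz := toComplex_mem_strip hp.2
  have hF' := hF.deriv isOpen_strip
  have h1 : dxx (fun r => r.2 * (F (toComplex r)).im) p =
      p.2 * (deriv (deriv F) (toComplex p)).im := by
    refine (HasSecondDerivAt.of_hasDerivAt
      (f' := fun t => p.2 * (deriv F (toComplex (t, p.2))).im)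
      (hasSecondDerivAt_dxx hc hp).1 ?_ ?_).2
    · filter_upwards [eventually_slice_fst (eventually_toComplex_mem_strip hp)] with t ht
      exact (HasDerivAt.complex_im (hasDerivAt_horizontal
        (hasDerivAt_of_mem_strip hF ht))).const_mul _
    · exact (HasDerivAt.complex_im (hasDerivAt_horizontal
        (hasDerivAt_of_mem_strip hF' hz))).const_mul _
  have h2 : dyy (fun r => r.2 * (F (toComplex r)).im) p =
      2 * (deriv F (toComplex p)).re - p.2 * (deriv (deriv F) (toComplex p)).im := by
    refine (HasSecondDerivAt.of_hasDerivAt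
      (f' := fun t => (F (toComplex (p.1, t))).im + t * (deriv F (toComplex (p.1, t))).re)
      (hasSecondDerivAt_dyy hc hp).1 ?_ ?_).2
    · filter_upwards [eventually_slice_snd (eventually_toComplex_mem_strip hp)] with t ht
      exact ((hasDerivAt_id t).mul (HasDerivAt.complex_im (hasDerivAt_vertical
        (hasDerivAt_of_mem_strip hF ht)))).congr_deriv (by simp)
    · exact ((HasDerivAt.complex_im (hasDerivAt_vertical
        (hasDerivAt_of_mem_strip hF hz))).add ((hasDerivAt_id p.2).mul
        (HasDerivAt.complex_re (hasDerivAt_vertical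
          (hasDerivAt_of_mem_strip hF' hz))))).congr_deriv (by simp; ring)
  rw [lap, h1, h2]
  ring

end Holomorphic

/-! ### Sine series with exponentially small coefficients. -/

/-- The odd frequencies `(2j+1)π/2`. -/
def freq (j : ℕ) : ℝ := (2 * j + 1) * Real.pi / 2

theorem freq_pos (j : ℕ) : 0 < freq j := by
  unfold freq
  positivity

theorem freq_eq (j : ℕ) : freq j = Real.pi / 2 + j * Real.pi := by
  unfold freq
  ring

theorem one_le_freq (j : ℕ) : 1 ≤ freq j := by
  have := Real.pi_gt_three
  rw [freq_eq]
  nlinarith [(Nat.cast_nonneg j : (0 : ℝ) ≤ j)]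

theorem exp_neg_freq_mul (a : ℝ) (j : ℕ) : Real.exp (-(freq j * a)) =
    Real.exp (-(Real.pi / 2 * a)) * Real.exp (-(Real.pi * a)) ^ j := by
  rw [← Real.exp_nat_mul, ← Real.exp_add, freq_eq]
  ring_nf

theorem exp_neg_pi_mul_lt_one {a : ℝ} (ha : 0 < a) : Real.exp (-(Real.pi * a)) < 1 := by
  rw [Real.exp_lt_one_iff]
  have := mul_pos Real.pi_pos ha
  linarith

theorem hasSum_exp_neg_freq_mul {a : ℝ} (ha : 0 < a) :
    HasSum (fun j => Real.exp (-(freq j * a)))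
      (Real.exp (-(Real.pi / 2 * a)) * (1 - Real.exp (-(Real.pi * a)))⁻¹) := by
  simp_rw [exp_neg_freq_mul]
  exact (hasSum_geometric_of_lt_one (Real.exp_pos _).le (exp_neg_pi_mul_lt_one ha)).mul_left _

theorem summable_exp_neg_freq : Summable fun j => Real.exp (-freq j) := by
  simpa using (hasSum_exp_neg_freq_mul one_pos).summable

theorem norm_complex_sin_le (z : ℂ) : ‖Complex.sin z‖ ≤ Real.exp |z.im| := by
  have h1 : ‖Complex.exp (-z * Complex.I)‖ ≤ Real.exp |z.im| := by
    rw [Complex.norm_exp]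
    simpa using le_abs_self z.im
  have h2 : ‖Complex.exp (z * Complex.I)‖ ≤ Real.exp |z.im| := by
    rw [Complex.norm_exp]
    simpa using neg_le_abs z.im
  rw [Complex.sin, norm_div, norm_mul, Complex.norm_I, mul_one, Complex.norm_ofNat]
  have := norm_sub_le (Complex.exp (-z * Complex.I)) (Complex.exp (z * Complex.I))
  linarith

/-- The sine series `∑ c j sin (freq j * (z + 1))`. -/
def sineSeries (c : ℕ → ℝ) (z : ℂ) : ℂ := ∑' j, c j * Complex.sin (freq j * (z + 1))

section SineSeries

variable {c : ℕ → ℝ} {K : ℝ}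

/-- On a substrip of half-width `ρ < 1` the growth `exp(freq j * ρ)` of the sine loses to the decay
`exp(-freq j)` of the coefficients. This geometric majorant gives local uniform convergence, hence
holomorphy. -/
theorem norm_sineSeries_term_le (hc : ∀ j, |c j| ≤ K * Real.exp (-freq j)) {ρ : ℝ} {z : ℂ}
    (hz : |z.im| < ρ) (j : ℕ) :
    ‖(c j : ℂ) * Complex.sin (freq j * (z + 1))‖ ≤ K * Real.exp (-(freq j * (1 - ρ))) := by
  have h1 : ‖Complex.sin (freq j * (z + 1))‖ ≤ Real.exp (freq j * ρ) := by
    refine (norm_complex_sin_le _).trans (Real.exp_le_exp.2 ?_)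
    have : ((freq j : ℂ) * (z + 1)).im = freq j * z.im := by simp
    rw [this, abs_mul, abs_of_pos (freq_pos j)]
    exact mul_le_mul_of_nonneg_left hz.le (freq_pos j).le
  rw [norm_mul, Complex.norm_real, Real.norm_eq_abs]
  calc |c j| * ‖Complex.sin (freq j * (z + 1))‖
      ≤ K * Real.exp (-freq j) * Real.exp (freq j * ρ) :=
        mul_le_mul (hc j) h1 (norm_nonneg _) ((abs_nonneg _).trans (hc j))
    _ = K * Real.exp (-(freq j * (1 - ρ))) := by
        rw [mul_assoc, ← Real.exp_add]
        ring_nf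

theorem summable_bound {ρ : ℝ} (hρ : ρ < 1) :
    Summable fun j => K * Real.exp (-(freq j * (1 - ρ))) :=
  (hasSum_exp_neg_freq_mul (sub_pos.2 hρ)).summable.mul_left K

theorem hasSum_sineSeries (hc : ∀ j, |c j| ≤ K * Real.exp (-freq j)) {z : ℂ} (hz : z ∈ strip) :
    HasSum (fun j => (c j : ℂ) * Complex.sin (freq j * (z + 1))) (sineSeries c z) := by
  obtain ⟨ρ, h1, h2⟩ := exists_between (show |z.im| < 1 from hz)
  exact (Summable.of_norm_bounded (summable_bound h2)
    (norm_sineSeries_term_le hc h1)).hasSum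

theorem isOpen_strip_of_radius (ρ : ℝ) : IsOpen {z : ℂ | |z.im| < ρ} :=
  isOpen_lt (f := fun z : ℂ => |z.im|) (Complex.continuous_im.abs) continuous_const

theorem differentiableOn_sineSeries (hc : ∀ j, |c j| ≤ K * Real.exp (-freq j)) :
    DifferentiableOn ℂ (sineSeries c) strip := by
  intro z hz
  obtain ⟨ρ, h1, h2⟩ := exists_between (show |z.im| < 1 from hz)
  have := Complex.differentiableOn_tsum_of_summable_norm (summable_bound h2)
    (F := fun j z => (c j : ℂ) * Complex.sin (freq j * (z + 1)))
    (fun j => by fun_prop) (isOpen_strip_of_radius ρ)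
    (fun j w hw => norm_sineSeries_term_le hc hw j)
  exact (this.differentiableAt ((isOpen_strip_of_radius ρ).mem_nhds h1)).differentiableWithinAt

theorem hasSum_deriv_sineSeries (hc : ∀ j, |c j| ≤ K * Real.exp (-freq j)) {z : ℂ}
    (hz : z ∈ strip) :
    HasSum (fun j => (c j : ℂ) * (freq j * Complex.cos (freq j * (z + 1))))
      (deriv (sineSeries c) z) := by
  obtain ⟨ρ, h1, h2⟩ := exists_between (show |z.im| < 1 from hz)
  have := Complex.hasSum_deriv_of_summable_norm (summable_bound h2)
    (F := fun j z => (c j : ℂ) * Complex.sin (freq j * (z + 1)))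
    (fun j => by fun_prop) (isOpen_strip_of_radius ρ)
    (fun j w hw => norm_sineSeries_term_le hc hw j) h1
  have hd : ∀ j, deriv (fun z => (c j : ℂ) * Complex.sin (freq j * (z + 1))) z =
      c j * (freq j * Complex.cos (freq j * (z + 1))) := fun j => by
    have h : HasDerivAt (fun z : ℂ => (freq j : ℂ) * (z + 1)) (freq j) z := by
      simpa using ((hasDerivAt_id z).add_const 1).const_mul (freq j : ℂ)
    rw [(h.csin.const_mul (c j : ℂ)).deriv, mul_comm (Complex.cos _)]
  simp_rw [hd] at this
  exact this

theorem hasSum_sineSeries_re (hc : ∀ j, |c j| ≤ K * Real.exp (-freq j)) {p : ℝ × ℝ}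
    (hp : |p.2| < 1) :
    HasSum (fun j => c j * (Real.sin (freq j * (p.1 + 1)) * Real.cosh (freq j * p.2)))
      (sineSeries c (toComplex p)).re := by
  convert Complex.hasSum_re (hasSum_sineSeries hc (toComplex_mem_strip hp)) using 2 with j
  have : (freq j : ℂ) * (toComplex p + 1) =
      ((freq j * (p.1 + 1) : ℝ) : ℂ) + ((freq j * p.2 : ℝ) : ℂ) * Complex.I := by
    simp only [toComplex]
    push_cast
    ring
  rw [this]
  generalize freq j * (p.1 + 1) = a, freq j * p.2 = b
  simp [Complex.sin_add_mul_I, Complex.sin_ofReal_re]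

theorem hasSum_deriv_sineSeries_im (hc : ∀ j, |c j| ≤ K * Real.exp (-freq j)) {p : ℝ × ℝ}
    (hp : |p.2| < 1) :
    HasSum (fun j => -(c j * freq j * (Real.sin (freq j * (p.1 + 1)) * Real.sinh (freq j * p.2))))
      (deriv (sineSeries c) (toComplex p)).im := by
  convert Complex.hasSum_im (hasSum_deriv_sineSeries hc (toComplex_mem_strip hp)) using 2 with j
  have : (freq j : ℂ) * (toComplex p + 1) =
      ((freq j * (p.1 + 1) : ℝ) : ℂ) + ((freq j * p.2 : ℝ) : ℂ) * Complex.I := by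
    simp only [toComplex]
    push_cast
    ring
  rw [this]
  generalize freq j * (p.1 + 1) = a, freq j * p.2 = b
  simp [Complex.cos_add_mul_I, mul_assoc, Complex.sin_ofReal_re, Complex.sinh_ofReal_re]

end SineSeries

/-! ### The two explicit functions on the strip. -/

theorem inv_cosh_le (x : ℝ) : 1 / Real.cosh x ≤ 2 * Real.exp (-x) := by
  rw [div_le_iff₀ (Real.cosh_pos x), Real.cosh_eq, mul_assoc, mul_div_assoc', mul_add,
    ← Real.exp_add, ← Real.exp_add]
  have := Real.exp_pos (-x + -x)
  simp only [neg_add_cancel, Real.exp_zero]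
  linarith

/-- Coefficients of the harmonic function that is `1` on `y = ±1` and `0` on `x = ±1`. -/
def coeffU (j : ℕ) : ℝ := 2 / (freq j * Real.cosh (freq j))

/-- Coefficients of the harmonic part of the solution of the Poisson problem. -/
def coeffH (j : ℕ) : ℝ := Real.sinh (freq j) / Real.cosh (freq j) ^ 2

theorem abs_coeffU_le (j : ℕ) : |coeffU j| ≤ 4 * Real.exp (-freq j) := by
  have h1 := inv_cosh_le (freq j)
  have h2 := one_le_freq j
  have h3 := Real.cosh_pos (freq j)
  rw [coeffU, abs_of_pos (by have := freq_pos j; positivity), div_le_iff₀ (by positivity)]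
  rw [div_le_iff₀ h3] at h1
  have : 2 * Real.exp (-freq j) * Real.cosh (freq j) * 1 ≤
    2 * Real.exp (-freq j) * Real.cosh (freq j) * freq j := by gcongr
  nlinarith

theorem abs_coeffH_le (j : ℕ) : |coeffH j| ≤ 4 * Real.exp (-freq j) := by
  have h1 := inv_cosh_le (freq j)
  have h3 := Real.cosh_pos (freq j)
  have h4 : 0 < Real.sinh (freq j) := Real.sinh_pos_iff.2 (freq_pos j)
  have h5 := (Real.sinh_lt_cosh (freq j)).le
  rw [coeffH, abs_of_pos (by positivity)]
  calc Real.sinh (freq j) / Real.cosh (freq j) ^ 2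
      ≤ Real.cosh (freq j) / Real.cosh (freq j) ^ 2 := by gcongr
    _ = 1 / Real.cosh (freq j) := by field_simp
    _ ≤ 4 * Real.exp (-freq j) := by linarith [Real.exp_pos (-freq j)]

/-- The harmonic function on the strip `|y| < 1` that vanishes on `x = ±1` and tends to `1` at
`y = ±1`, `|x| < 1`. -/
def stripU (p : ℝ × ℝ) : ℝ := (sineSeries coeffU (toComplex p)).re

/-- The solution of `Δu = (stripU)_xx` on the strip `|y| < 1` that vanishes on `x = ±1`. -/
def stripH (p : ℝ × ℝ) : ℝ := (sineSeries coeffH (toComplex p)).re +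
  1 / 2 * (p.2 * (deriv (sineSeries coeffU) (toComplex p)).im)

/-- The sine modes of `stripH`, as functions of `y`. -/
def mode (k y : ℝ) : ℝ :=
  (Real.sinh k * Real.cosh (k * y) - y * Real.sinh (k * y) * Real.cosh k) / Real.cosh k ^ 2

theorem hasSum_stripU {p : ℝ × ℝ} (hp : |p.2| < 1) :
    HasSum (fun j => 2 / freq j * Real.sin (freq j * (p.1 + 1)) *
      (Real.cosh (freq j * p.2) / Real.cosh (freq j))) (stripU p) := by
  rw [stripU]
  convert hasSum_sineSeries_re abs_coeffU_le hp using 2 with j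
  rw [coeffU]
  have := Real.cosh_pos (freq j)
  have := freq_pos j
  field_simp

theorem hasSum_stripH {p : ℝ × ℝ} (hp : |p.2| < 1) :
    HasSum (fun j => Real.sin (freq j * (p.1 + 1)) * mode (freq j) p.2) (stripH p) := by
  rw [stripH]
  convert (hasSum_sineSeries_re abs_coeffH_le hp).add
    (((hasSum_deriv_sineSeries_im abs_coeffU_le hp).mul_left p.2).mul_left (1 / 2)) using 2 with j
  rw [coeffU, coeffH, mode]
  have := Real.cosh_pos (freq j)
  have := freq_pos j
  field_simp
  ring

theorem contDiffOn_stripU : ContDiffOn ℝ 2 stripU {p : ℝ × ℝ | |p.2| < 1} :=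
  contDiffOn_re (differentiableOn_sineSeries abs_coeffU_le)

theorem contDiffOn_stripH : ContDiffOn ℝ 2 stripH {p : ℝ × ℝ | |p.2| < 1} :=
  (contDiffOn_re (differentiableOn_sineSeries abs_coeffH_le)).add
    (contDiffOn_const.mul (contDiffOn_mul_im
      ((differentiableOn_sineSeries abs_coeffU_le).deriv isOpen_strip)))

theorem dyy_stripU {p : ℝ × ℝ} (hp : p ∈ square) : dyy stripU p = -dxx stripU p := by
  rw [show stripU = fun r => (sineSeries coeffU (toComplex r)).re from rfl,
    dyy_re (differentiableOn_sineSeries abs_coeffU_le) hp,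
    dxx_re (differentiableOn_sineSeries abs_coeffU_le) hp]

theorem lap_add_const_mul {u v : ℝ × ℝ → ℝ} (a b : ℝ) (hu : ContDiffOn ℝ 2 u square)
    (hv : ContDiffOn ℝ 2 v square) {p : ℝ × ℝ} (hp : p ∈ square) :
    lap (fun r => a * u r + b * v r) p = a * lap u p + b * lap v p := by
  have h1 := (((hasSecondDerivAt_dxx hu hp).const_mul a).add
    ((hasSecondDerivAt_dxx hv hp).const_mul b)).eq
  have h2 := (((hasSecondDerivAt_dyy hu hp).const_mul a).add
    ((hasSecondDerivAt_dyy hv hp).const_mul b)).eq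
  rw [lap, dxx, dyy, h1, h2, lap, lap]
  ring

theorem lap_stripH {p : ℝ × ℝ} (hp : p ∈ square) : lap stripH p = dxx stripU p := by
  have hU := differentiableOn_sineSeries abs_coeffU_le
  have hH := differentiableOn_sineSeries abs_coeffH_le
  have h := lap_add_const_mul 1 (1 / 2) ((contDiffOn_re hH).mono square_subset_horizontal_strip)
    ((contDiffOn_mul_im (hU.deriv isOpen_strip)).mono square_subset_horizontal_strip) hp
  have h0 : lap (fun r => (sineSeries coeffH (toComplex r)).re) p = 0 := by
    rw [lap, dxx_re hH hp, dyy_re hH hp, add_neg_cancel]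
  rw [lap_mul_im (hU.deriv isOpen_strip) hp, h0] at h
  simp only [one_mul] at h
  rw [show stripU = fun r => (sineSeries coeffU (toComplex r)).re from rfl, dxx_re hU hp]
  refine h.trans ?_
  ring

theorem sin_freq_mul_two (j : ℕ) : Real.sin (freq j * 2) = 0 := by
  have : freq j * 2 = ((2 * j + 1 : ℕ) : ℝ) * Real.pi := by
    unfold freq
    push_cast
    ring
  rw [this, Real.sin_nat_mul_pi]

theorem sin_freq_mul_of_abs_eq_one (j : ℕ) {x : ℝ} (hx : |x| = 1) :
    Real.sin (freq j * (x + 1)) = 0 := by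
  rcases (abs_eq zero_le_one).1 hx with rfl | rfl
  · rw [show (1 : ℝ) + 1 = 2 by norm_num, sin_freq_mul_two]
  · simp

theorem stripU_eq_zero {p : ℝ × ℝ} (h1 : |p.1| = 1) (h2 : |p.2| < 1) : stripU p = 0 := by
  refine (hasSum_stripU h2).unique ?_
  simp_rw [sin_freq_mul_of_abs_eq_one _ h1]
  simp

theorem stripH_eq_zero {p : ℝ × ℝ} (h1 : |p.1| = 1) (h2 : |p.2| < 1) : stripH p = 0 := by
  refine (hasSum_stripH h2).unique ?_
  simp_rw [sin_freq_mul_of_abs_eq_one _ h1]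
  simp

/-! ### Boundary values of the harmonic function at `y = ±1`. -/

theorem hasSum_of_eq {E : Type*} [NormedAddCommGroup E] {f g : ℕ → E} {a : E} (h : HasSum f a)
    (e : ∀ j, g j = f j) : HasSum g a :=
  (funext e : g = f) ▸ h

/-- This is the series of `artanh z`, obtained from that of the arctangent through `artanh z = i
arctan(-i z)`. -/
theorem hasSum_odd_log {z : ℂ} (hz : ‖z‖ < 1) :
    HasSum (fun j : ℕ => z ^ (2 * j + 1) / ((2 * j + 1 : ℕ) : ℂ))
      (1 / 2 * Complex.log ((1 + z) / (1 - z))) := by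
  have h := (Complex.hasSum_arctan (z := -Complex.I * z) (by simpa using hz)).mul_left Complex.I
  have e : Complex.I * Complex.arctan (-Complex.I * z) =
      1 / 2 * Complex.log ((1 + z) / (1 - z)) := by
    have h1 : -Complex.I * z * Complex.I = z := by
      linear_combination (-z) * Complex.I_mul_I
    rw [Complex.arctan, h1]
    linear_combination (-1 / 2 * Complex.log ((1 + z) / (1 - z))) * Complex.I_mul_I
  rw [e] at h
  refine hasSum_of_eq h fun j => ?_
  have h2 : (-Complex.I * z) ^ (2 * j + 1) = (-1) ^ j * (-Complex.I) * z ^ (2 * j + 1) := by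
    rw [mul_pow, pow_succ, pow_mul, neg_sq, Complex.I_sq]
  have h3 : ((-1 : ℂ) ^ j) * (-1) ^ j = 1 := by rw [← mul_pow]; simp
  rw [h2]
  linear_combination (z ^ (2 * j + 1) / ((2 * j + 1 : ℕ) : ℂ)) * (Complex.I_mul_I +
    Complex.I * Complex.I * h3)

/-- The nome `exp ((π/2) (i (x + 1) - (1 - y)))`. -/
def nome (p : ℝ × ℝ) : ℂ :=
  Complex.exp (((-(Real.pi / 2 * (1 - p.2)) : ℝ) : ℂ) +
    ((Real.pi / 2 * (p.1 + 1) : ℝ) : ℂ) * Complex.I)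

theorem norm_nome (p : ℝ × ℝ) : ‖nome p‖ = Real.exp (-(Real.pi / 2 * (1 - p.2))) := by
  rw [nome, Complex.norm_exp]
  simp

theorem nome_pow (p : ℝ × ℝ) (j : ℕ) : nome p ^ (2 * j + 1) =
    Complex.exp (((-(freq j * (1 - p.2)) : ℝ) : ℂ) +
      ((freq j * (p.1 + 1) : ℝ) : ℂ) * Complex.I) := by
  rw [nome, ← Complex.exp_nat_mul]
  congr 1
  unfold freq
  push_cast
  ring

theorem continuous_nome : Continuous nome := by
  unfold nome
  fun_prop

/-- The part of `stripU` coming from the edge `y = 1`. -/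
def edgePart (p : ℝ × ℝ) : ℝ := 2 / Real.pi * ((1 + nome p) / (1 - nome p)).arg

theorem hasSum_edgePart {p : ℝ × ℝ} (hp : p.2 < 1) :
    HasSum (fun j => 2 / freq j * Real.sin (freq j * (p.1 + 1)) *
      Real.exp (-(freq j * (1 - p.2)))) (edgePart p) := by
  have hz : ‖nome p‖ < 1 := by
    rw [norm_nome, Real.exp_lt_one_iff]
    have := mul_pos (half_pos Real.pi_pos) (sub_pos.2 hp)
    linarith
  have h := (Complex.hasSum_im (hasSum_odd_log hz)).mul_left (4 / Real.pi)
  have e : edgePart p = 4 / Real.pi * (1 / 2 * Complex.log ((1 + nome p) / (1 - nome p))).im := by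
    rw [edgePart, show (1 / 2 : ℂ) = ((1 / 2 : ℝ) : ℂ) by push_cast; rfl, Complex.im_ofReal_mul,
      Complex.log_im]
    ring
  rw [e]
  refine hasSum_of_eq h fun j => ?_
  rw [nome_pow, show (((2 * j + 1 : ℕ) : ℂ)) = (((2 * j + 1 : ℝ)) : ℂ) by push_cast; rfl,
    Complex.div_ofReal_im, Complex.exp_im]
  simp only [Complex.add_re, Complex.ofReal_re, Complex.mul_re, Complex.I_re, Complex.ofReal_im,
    Complex.I_im, Complex.add_im, Complex.mul_im, mul_zero, mul_one, sub_zero, add_zero, zero_add]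
  unfold freq
  have := Real.pi_pos
  field_simp
  ring

theorem abs_edgePart_le (p : ℝ × ℝ) : |edgePart p| ≤ 2 := by
  rw [edgePart, abs_mul, abs_of_pos (by have := Real.pi_pos; positivity)]
  calc 2 / Real.pi * |((1 + nome p) / (1 - nome p)).arg| ≤ 2 / Real.pi * Real.pi := by
        have := Real.pi_pos
        gcongr
        exact Complex.abs_arg_le_pi _
    _ = 2 := by field_simp

theorem nome_edge (x : ℝ) : nome (x, 1) =
    ((Real.cos (Real.pi / 2 * (x + 1)) : ℝ) : ℂ) +
      ((Real.sin (Real.pi / 2 * (x + 1)) : ℝ) : ℂ) * Complex.I := by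
  rw [nome]
  simp only [sub_self, mul_zero, neg_zero, Complex.ofReal_zero, zero_add]
  rw [Complex.exp_mul_I, Complex.ofReal_cos, Complex.ofReal_sin]

theorem sin_pos_of_abs_lt_one {x : ℝ} (hx : |x| < 1) : 0 < Real.sin (Real.pi / 2 * (x + 1)) := by
  rw [abs_lt] at hx
  have := Real.pi_pos
  apply Real.sin_pos_of_pos_of_lt_pi <;> nlinarith

/-- On the unit circle `(1+z)/(1-z)` is purely imaginary, and it is on the positive half-axis when
`Im z > 0`. So its argument is `π/2` and is continuous there, which gives the boundary value `1`. -/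
theorem edge_quotient {x : ℝ} (hx : |x| < 1) :
    ((1 + nome (x, 1)) / (1 - nome (x, 1))).re = 0 ∧
      0 < ((1 + nome (x, 1)) / (1 - nome (x, 1))).im := by
  have hs := sin_pos_of_abs_lt_one hx
  have hcs := Real.sin_sq_add_cos_sq (Real.pi / 2 * (x + 1))
  rw [nome_edge]
  set s := Real.sin (Real.pi / 2 * (x + 1))
  set c := Real.cos (Real.pi / 2 * (x + 1))
  have hn : 0 < Complex.normSq (1 - ((c : ℂ) + (s : ℂ) * Complex.I)) := by
    rw [Complex.normSq_pos]
    intro h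
    have := congrArg Complex.im h
    simp at this
    exact hs.ne' this
  rw [Complex.div_re, Complex.div_im]
  constructor
  · rw [← add_div, div_eq_zero_iff]
    left
    simp
    linarith
  · rw [← sub_div]
    apply div_pos _ hn
    simp
    nlinarith

theorem edgePart_edge {x : ℝ} (hx : |x| < 1) : edgePart (x, 1) = 1 := by
  rw [edgePart, Complex.arg_eq_pi_div_two_iff.2 (edge_quotient hx)]
  have := Real.pi_pos
  field_simp

theorem continuousAt_edgePart {x : ℝ} (hx : |x| < 1) : ContinuousAt edgePart (x, 1) := by
  obtain ⟨h1, h2⟩ := edge_quotient hx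
  refine continuousAt_const.mul ((Complex.continuousAt_arg ?_).comp (f := fun p =>
    (1 + nome p) / (1 - nome p)) ?_)
  · exact Complex.mem_slitPlane_iff.2 (Or.inr h2.ne')
  · refine ContinuousAt.div (by have := continuous_nome; fun_prop)
      (by have := continuous_nome; fun_prop) fun h => ?_
    rw [h, div_zero] at h2
    exact lt_irrefl _ h2

/-- The remainder `stripU - edgePart`, for `0 ≤ y ≤ 1`. -/
def edgeRest (p : ℝ × ℝ) : ℝ :=
  ∑' j, 2 / freq j * Real.sin (freq j * (p.1 + 1)) *
    (Real.exp (-freq j) * (Real.sinh (freq j * (1 - p.2)) / Real.cosh (freq j)))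

theorem norm_edgeRest_term_le {p : ℝ × ℝ} (h0 : 0 ≤ p.2) (h1 : p.2 ≤ 1) (j : ℕ) :
    ‖2 / freq j * Real.sin (freq j * (p.1 + 1)) *
      (Real.exp (-freq j) * (Real.sinh (freq j * (1 - p.2)) / Real.cosh (freq j)))‖ ≤
      2 * Real.exp (-freq j) := by
  have hk := one_le_freq j
  have hkp := freq_pos j
  have hs : |Real.sinh (freq j * (1 - p.2)) / Real.cosh (freq j)| ≤ 1 := by
    rw [abs_div, abs_of_pos (Real.cosh_pos _), div_le_one (Real.cosh_pos _),
      abs_of_nonneg (Real.sinh_nonneg_iff.2 (mul_nonneg hkp.le (by linarith)))]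
    refine (Real.sinh_le_sinh.2 ?_).trans (Real.sinh_lt_cosh _).le
    nlinarith
  have hf : |2 / freq j| ≤ 2 := by
    rw [abs_of_pos (by positivity), div_le_iff₀ hkp]
    linarith
  rw [Real.norm_eq_abs, abs_mul, abs_mul, abs_mul, abs_of_pos (Real.exp_pos _)]
  calc _ ≤ 2 * 1 * (Real.exp (-freq j) * 1) := by
        gcongr
        exact Real.abs_sin_le_one _
    _ = _ := by ring

theorem continuousOn_edgeRest : ContinuousOn edgeRest {p | 0 ≤ p.2 ∧ p.2 ≤ 1} :=
  continuousOn_tsum (fun j => by fun_prop) (summable_exp_neg_freq.mul_left 2)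
    fun j p hp => norm_edgeRest_term_le hp.1 hp.2 j

theorem abs_edgeRest_le {p : ℝ × ℝ} (h0 : 0 ≤ p.2) (h1 : p.2 ≤ 1) :
    |edgeRest p| ≤ ∑' j, 2 * Real.exp (-freq j) :=
  tsum_of_norm_bounded (summable_exp_neg_freq.mul_left 2).hasSum
    fun j => norm_edgeRest_term_le h0 h1 j

theorem edgeRest_edge (x : ℝ) : edgeRest (x, 1) = 0 := by
  simp [edgeRest]

/-- Termwise, `cosh(ky)/cosh k = exp(-k(1-y)) + exp(-k) sinh(k(1-y))/cosh k`. The second part keeps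
the summable factor `exp(-k)` up to `y = 1`. -/
theorem stripU_eq_edge {p : ℝ × ℝ} (h0 : 0 ≤ p.2) (h1 : p.2 < 1) :
    stripU p = edgePart p + edgeRest p := by
  have hR : HasSum _ (edgeRest p) := (Summable.of_norm_bounded
    (summable_exp_neg_freq.mul_left 2) fun j => norm_edgeRest_term_le h0 h1.le j).hasSum
  refine (hasSum_stripU (by rw [abs_of_nonneg h0]; exact h1)).unique ?_
  convert (hasSum_edgePart h1).add hR using 2 with j
  rw [← mul_add]
  congr 1
  have h := (Real.cosh_pos (freq j)).ne'
  rw [div_eq_iff h, add_mul, mul_assoc (Real.exp (-freq j)), div_mul_cancel₀ _ h,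
    Real.cosh_eq, Real.cosh_eq, Real.sinh_eq, mul_div_assoc', mul_div_assoc', mul_add (Real.exp _),
    mul_sub (Real.exp _), ← Real.exp_add, ← Real.exp_add, ← Real.exp_add, ← Real.exp_add]
  ring_nf

theorem stripU_abs {p : ℝ × ℝ} (hp : |p.2| < 1) : stripU (p.1, |p.2|) = stripU p := by
  refine (hasSum_stripU (p := (p.1, |p.2|)) (by simpa using hp)).unique ?_
  refine hasSum_of_eq (hasSum_stripU hp) fun j => ?_
  rcases abs_choice p.2 with h | h <;> simp [h, Real.cosh_neg]

/-! ### Existence and uniqueness of the leading order profile. -/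

/-- The leading order profile at `lam = 0`, for boundary values `± s / 2`. -/
def harmonicProfile (s : ℝ) (p : ℝ × ℝ) : ℝ := if |p.2| < 1 then s * (stripU p - 1 / 2) else s / 2

theorem isOpen_horizontal_strip : IsOpen {p : ℝ × ℝ | |p.2| < 1} :=
  isOpen_lt (f := fun p : ℝ × ℝ => |p.2|) (by fun_prop) continuous_const

theorem eqOn_harmonicProfile (s : ℝ) :
    Set.EqOn (harmonicProfile s) (fun p => s * (stripU p - 1 / 2)) {p : ℝ × ℝ | |p.2| < 1} :=
  fun _ hp => if_pos hp

theorem contDiffOn_harmonicProfile (s : ℝ) :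
    ContDiffOn ℝ 2 (harmonicProfile s) {p : ℝ × ℝ | |p.2| < 1} :=
  (contDiffOn_const.mul (contDiffOn_stripU.sub contDiffOn_const)).congr (eqOn_harmonicProfile s)

theorem harmonicProfile_eq_edge (s : ℝ) {p : ℝ × ℝ} (hp : p ∈ closedSquare \ corners) :
    harmonicProfile s p = s * (edgePart (p.1, |p.2|) + edgeRest (p.1, |p.2|) - 1 / 2) := by
  by_cases h : |p.2| < 1
  · rw [harmonicProfile, if_pos h, ← stripU_abs h, stripU_eq_edge (abs_nonneg _) h]
  · have h2 : |p.2| = 1 := le_antisymm hp.1.2 (not_lt.1 h)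
    have h1 : |p.1| < 1 := lt_of_le_of_ne hp.1.1 fun h1 => hp.2 ⟨h1, h2⟩
    rw [harmonicProfile, if_neg h, h2, edgePart_edge h1, edgeRest_edge]
    ring

theorem isRegular_harmonicProfile (s : ℝ) : IsRegular (harmonicProfile s) := by
  refine ⟨(contDiffOn_harmonicProfile s).mono square_subset_horizontal_strip, fun p hp => ?_,
    max (|s| * (2 + ∑' j, 2 * Real.exp (-freq j) + 1 / 2)) |s / 2|, fun p hp => ?_⟩
  · by_cases h : |p.2| < 1
    · exact ((contDiffOn_harmonicProfile s).continuousOn.continuousAt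
        (isOpen_horizontal_strip.mem_nhds h)).continuousWithinAt
    · have h2 : |p.2| = 1 := le_antisymm hp.1.2 (not_lt.1 h)
      have h1 : |p.1| < 1 := lt_of_le_of_ne hp.1.1 fun h1 => hp.2 ⟨h1, h2⟩
      have hc : ContinuousWithinAt (fun r => s * (edgePart r + edgeRest r - 1 / 2))
          {r | 0 ≤ r.2 ∧ r.2 ≤ 1} (p.1, |p.2|) := by
        rw [h2]
        exact continuousWithinAt_const.mul (((continuousAt_edgePart h1).continuousWithinAt.add
          (continuousOn_edgeRest (p.1, 1) ⟨zero_le_one, le_rfl⟩)).sub continuousWithinAt_const)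
      refine (hc.comp (f := fun r : ℝ × ℝ => (r.1, |r.2|)) (s := closedSquare \ corners)
        (by fun_prop) fun r hr => ⟨abs_nonneg _, hr.1.2⟩).congr (fun r hr => ?_) ?_
      · exact harmonicProfile_eq_edge s hr
      · exact harmonicProfile_eq_edge s hp
  · by_cases h : |p.2| < 1
    · refine le_max_of_le_left ?_
      rw [harmonicProfile, if_pos h, ← stripU_abs h, stripU_eq_edge (abs_nonneg _) h, abs_mul]
      gcongr
      have h1 := abs_edgePart_le (p.1, |p.2|)
      have h2 := abs_edgeRest_le (p := (p.1, |p.2|)) (abs_nonneg _) h.le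
      rw [abs_le] at h1 h2 ⊢
      constructor <;> linarith
    · rw [harmonicProfile, if_neg h]
      exact le_max_right _ _

theorem dxx_harmonicProfile (s : ℝ) {p : ℝ × ℝ} (hp : p ∈ square) :
    dxx (harmonicProfile s) p = s * dxx stripU p := by
  rw [dxx_congr (fun r hr => eqOn_harmonicProfile s hr.2) hp]
  have := ((hasSecondDerivAt_dxx (contDiffOn_stripU.mono square_subset_horizontal_strip) hp).sub
    (HasSecondDerivAt.const (1 / 2))).const_mul s
  rw [dxx, this.eq, sub_zero]

theorem dyy_harmonicProfile (s : ℝ) {p : ℝ × ℝ} (hp : p ∈ square) :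
    dyy (harmonicProfile s) p = -(s * dxx stripU p) := by
  rw [dyy_congr (fun r hr => eqOn_harmonicProfile s hr.2) hp]
  have := ((hasSecondDerivAt_dyy (contDiffOn_stripU.mono square_subset_horizontal_strip) hp).sub
    (HasSecondDerivAt.const (1 / 2))).const_mul s
  rw [dyy, this.eq, sub_zero, dyy_stripU hp, mul_neg]

theorem isLeadingOrder_harmonicProfile (B C L : ℝ) :
    IsLeadingOrder B C L 0 (harmonicProfile (sStar B C)) := by
  refine ⟨isRegular_harmonicProfile _, fun p hp => ?_, fun p h1 h2 => ?_, fun p h1 h2 => ?_⟩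
  · rw [lap, dxx_harmonicProfile _ hp, dyy_harmonicProfile _ hp]
    simp
  · rw [harmonicProfile, if_neg (by rw [h2]; exact lt_irrefl _)]
  · rw [harmonicProfile, if_pos h2, stripU_eq_zero h1 h2]
    ring

theorem eq_one_cases_of_mem_boundary {p : ℝ × ℝ} (hp : p ∈ boundary \ corners) :
    (|p.1| < 1 ∧ |p.2| = 1) ∨ (|p.1| = 1 ∧ |p.2| < 1) := by
  obtain ⟨⟨⟨h1, h2⟩, h3⟩, h4⟩ := hp
  rcases h1.lt_or_eq with h1 | h1
  · exact Or.inl ⟨h1, le_antisymm h2 (not_lt.1 fun h => h3 ⟨h1, h⟩)⟩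
  · exact Or.inr ⟨h1, lt_of_le_of_ne h2 fun h => h4 ⟨h1, h⟩⟩

theorem IsLeadingOrder.eqOn_harmonicProfile {B C L : ℝ} {q : ℝ × ℝ → ℝ}
    (hq : IsLeadingOrder B C L 0 q) : Set.EqOn q (harmonicProfile (sStar B C)) square := by
  have h0 := isLeadingOrder_harmonicProfile B C L
  refine eqOn_square_of_lap_eq hq.regular h0.regular (fun p hp => ?_) fun p hp => ?_
  · rw [hq.pde p hp, h0.pde p hp]
    simp
  · rcases eq_one_cases_of_mem_boundary hp with h | h
    · rw [hq.horizontal p h.1 h.2, h0.horizontal p h.1 h.2]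
    · rw [hq.vertical p h.1 h.2, h0.vertical p h.1 h.2]

/-! ### Sine expansion of the modes in `y`. -/

theorem cos_freq (j : ℕ) : Real.cos (freq j) = 0 := by
  rw [freq_eq, Real.cos_add_nat_mul_pi, Real.cos_pi_div_two, mul_zero]

theorem add_one_le_freq (j : ℕ) : (j : ℝ) + 1 ≤ freq j := by
  have := Real.pi_gt_three
  rw [freq_eq]
  nlinarith [(Nat.cast_nonneg j : (0 : ℝ) ≤ j)]

theorem summable_freq_rpow {r : ℝ} (hr : 1 < r) : Summable fun j => freq j ^ (-r) := by
  have h : Summable fun j : ℕ => ((j + 1 : ℕ) : ℝ) ^ (-r) :=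
    (summable_nat_add_iff 1).2 (Real.summable_nat_rpow.2 (by linarith))
  refine Summable.of_nonneg_of_le (fun j => Real.rpow_nonneg (freq_pos j).le _) (fun j => ?_) h
  refine Real.rpow_le_rpow_of_nonpos (by positivity) ?_ (by linarith)
  push_cast
  exact add_one_le_freq j

/-- The exponents sum to `2`, and `3/2 > 1` makes the resulting bound on `1/(k²+l²)` summable in
`l`. -/
theorem rpow_mul_rpow_le {k l : ℝ} (hk : 0 < k) (hl : 0 < l) :
    k ^ (1 / 2 : ℝ) * l ^ (3 / 2 : ℝ) ≤ k ^ 2 + l ^ 2 := by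
  have hM : 0 < max k l := lt_max_of_lt_left hk
  calc k ^ (1 / 2 : ℝ) * l ^ (3 / 2 : ℝ)
      ≤ (max k l) ^ (1 / 2 : ℝ) * (max k l) ^ (3 / 2 : ℝ) := by
        gcongr
        · exact le_max_left _ _
        · exact le_max_right _ _
    _ = (max k l) ^ 2 := by
        rw [← Real.rpow_add hM, ← Real.rpow_natCast]
        norm_num
    _ ≤ k ^ 2 + l ^ 2 := by
        rcases max_cases k l with ⟨h, _⟩ | ⟨h, _⟩ <;> rw [h] <;> nlinarith

theorem one_div_sq_add_sq_le {k l : ℝ} (hk : 0 < k) (hl : 0 < l) :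
    1 / (k ^ 2 + l ^ 2) ≤ k ^ (-(1 / 2) : ℝ) * l ^ (-(3 / 2) : ℝ) := by
  rw [Real.rpow_neg hk.le, Real.rpow_neg hl.le, ← mul_inv, ← one_div]
  exact one_div_le_one_div_of_le (by positivity) (rpow_mul_rpow_le hk hl)

/-- The Fourier coefficients of the solution of the Poisson problem. -/
def coeff (k l : ℝ) : ℝ := 4 * k * l / (k ^ 2 + l ^ 2) ^ 2

theorem coeff_comm (k l : ℝ) : coeff k l = coeff l k := by
  rw [coeff, coeff, add_comm (k ^ 2)]
  ring

theorem mode_one (k : ℝ) : mode k 1 = 0 := by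
  simp [mode, mul_comm]

theorem mode_neg (k y : ℝ) : mode k (-y) = mode k y := by
  simp [mode, Real.cosh_neg, Real.sinh_neg]

theorem continuous_mode (k : ℝ) : Continuous (mode k) := by
  unfold mode
  fun_prop

theorem hasDerivAt_mode (k y : ℝ) : HasDerivAt (mode k)
    ((k * Real.sinh k * Real.sinh (k * y) -
      (Real.sinh (k * y) + k * y * Real.cosh (k * y)) * Real.cosh k) / Real.cosh k ^ 2) y := by
  have h0 : HasDerivAt (fun t : ℝ => k * t) k y := by
    simpa using (hasDerivAt_id y).const_mul k
  have h := ((h0.cosh.const_mul (Real.sinh k)).sub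
    (((hasDerivAt_id y).mul h0.sinh).mul_const (Real.cosh k))).div_const (Real.cosh k ^ 2)
  exact h.congr_deriv (by simp only [id]; ring)

theorem hasDerivAt_deriv_mode (k y : ℝ) : HasDerivAt (fun y =>
    (k * Real.sinh k * Real.sinh (k * y) -
      (Real.sinh (k * y) + k * y * Real.cosh (k * y)) * Real.cosh k) / Real.cosh k ^ 2)
    (k ^ 2 * mode k y - 2 * k / Real.cosh k * Real.cosh (k * y)) y := by
  have h0 : HasDerivAt (fun t : ℝ => k * t) k y := by
    simpa using (hasDerivAt_id y).const_mul k
  have h := ((h0.sinh.const_mul (k * Real.sinh k)).sub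
    ((h0.sinh.add (h0.mul h0.cosh)).mul_const (Real.cosh k))).div_const (Real.cosh k ^ 2)
  refine h.congr_deriv ?_
  have := (Real.cosh_pos k).ne'
  rw [mode]
  field_simp
  ring

/-- An explicit antiderivative. For suitable `c`, `w = mode k y + c cosh(ky)` satisfies `w'' + l² w
= (k²+l²) mode k y`, so `exp(-ily)(w' + ilw)` differentiates to `k²+l²` times the integrand. The
condition `cos l = 0` makes the exponential `∓ i sin l` at `y = ±1`. -/
theorem integral_mode_mul_exp {k l : ℝ} (hk : 0 < k) (hl : Real.cos l = 0) :
    ∫ y in (-1 : ℝ)..1, (mode k y : ℂ) * Complex.exp (-(l * y * Complex.I)) =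
      ((coeff k l * Real.sin l : ℝ) : ℂ) := by
  have hD : (0 : ℝ) < k ^ 2 + l ^ 2 := by positivity
  have hDc : ((k : ℂ) ^ 2 + (l : ℂ) ^ 2) ≠ 0 := by exact_mod_cast hD.ne'
  -- Chosen to cancel the forcing term in `mode'' = k² mode - (2k/cosh k) cosh(ky)`.
  set c : ℝ := 2 * k / ((k ^ 2 + l ^ 2) * Real.cosh k) with hc
  set m' : ℝ → ℝ := fun y => (k * Real.sinh k * Real.sinh (k * y) -
      (Real.sinh (k * y) + k * y * Real.cosh (k * y)) * Real.cosh k) / Real.cosh k ^ 2 with hm'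
  have hcK : c * (k ^ 2 + l ^ 2) = 2 * k / Real.cosh k := by
    have := (Real.cosh_pos k).ne'
    rw [hc]
    field_simp
  have hE : ∀ y : ℝ, HasDerivAt (fun y : ℝ => Complex.exp (-(l * y * Complex.I)))
      (Complex.exp (-(l * y * Complex.I)) * (-(l * Complex.I))) y := fun y => by
    have h : HasDerivAt (fun y : ℝ => -((l : ℂ) * y * Complex.I)) (-(l * Complex.I)) y := by
      exact ((((hasDerivAt_id y).ofReal_comp).const_mul (l : ℂ)).mul_const
        Complex.I).fun_neg.congr_deriv (by simp)
    exact h.cexp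
  have hP : ∀ y : ℝ, HasDerivAt (fun y : ℝ => Complex.exp (-(l * y * Complex.I)) *
      (((m' y + c * (k * Real.sinh (k * y)) : ℝ) : ℂ) +
        l * Complex.I * ((mode k y + c * Real.cosh (k * y) : ℝ) : ℂ)) / ((k : ℂ) ^ 2 + (l : ℂ) ^ 2))
      ((mode k y : ℂ) * Complex.exp (-(l * y * Complex.I))) y := fun y => by
    have h0 : HasDerivAt (fun t : ℝ => k * t) k y := by
      simpa using (hasDerivAt_id y).const_mul k
    have h1 := ((hasDerivAt_deriv_mode k y).add ((h0.sinh.const_mul k).const_mul c)).ofReal_comp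
    have h2 := ((hasDerivAt_mode k y).add (h0.cosh.const_mul c)).ofReal_comp
    have h3 := ((hE y).mul (h1.add (h2.const_mul (l * Complex.I)))).div_const
      ((k : ℂ) ^ 2 + (l : ℂ) ^ 2)
    refine h3.congr_deriv ?_
    rw [div_eq_iff hDc]
    have hcK' : (c : ℂ) * ((k : ℂ) ^ 2 + (l : ℂ) ^ 2) = ((2 * k / Real.cosh k : ℝ) : ℂ) := by
      rw [← hcK]
      push_cast
      ring
    simp only [Pi.add_apply]
    push_cast at hcK' ⊢
    linear_combination (Complex.exp (-(l * y * Complex.I)) * Complex.cosh (k * y)) * hcK' +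
      (-(l : ℂ) ^ 2 * Complex.exp (-(l * y * Complex.I)) *
        ((mode k y : ℂ) + c * Complex.cosh (k * y))) * Complex.I_mul_I
  have hcont : Continuous fun y : ℝ => (mode k y : ℂ) * Complex.exp (-(l * y * Complex.I)) := by
    have := continuous_mode k
    fun_prop
  rw [intervalIntegral.integral_eq_sub_of_hasDerivAt (fun y _ => hP y)
    (hcont.intervalIntegrable _ _)]
  have e1 : Complex.exp (-(l * (1 : ℝ) * Complex.I)) = -(Real.sin l : ℂ) * Complex.I := by
    rw [show -((l : ℂ) * (1 : ℝ) * Complex.I) = ((-l : ℝ) : ℂ) * Complex.I by push_cast; ring,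
      Complex.exp_mul_I, ← Complex.ofReal_cos, ← Complex.ofReal_sin, Real.cos_neg, hl,
      Real.sin_neg]
    simp
  have e2 : Complex.exp (-(l * (-1 : ℝ) * Complex.I)) = (Real.sin l : ℂ) * Complex.I := by
    rw [show -((l : ℂ) * (-1 : ℝ) * Complex.I) = (l : ℂ) * Complex.I by push_cast; ring,
      Complex.exp_mul_I, ← Complex.ofReal_cos, ← Complex.ofReal_sin, hl]
    simp
  have e3 : m' (-1) = -m' 1 := by
    simp only [hm', mul_neg, mul_one, Real.sinh_neg, Real.cosh_neg]
    ring
  have e4 : c * Real.cosh k = 2 * k / (k ^ 2 + l ^ 2) := by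
    have := (Real.cosh_pos k).ne'
    rw [hc]
    field_simp
  have e5 : coeff k l * (k ^ 2 + l ^ 2) = 2 * l * (c * Real.cosh k) := by
    rw [e4, coeff]
    field_simp
    ring
  rw [e1, e2, e3, mode_neg, mode_one, mul_neg, mul_one, Real.sinh_neg, Real.cosh_neg,
    ← sub_div, div_eq_iff hDc]
  have e5' := congrArg (fun x : ℝ => (x : ℂ)) e5
  push_cast at e5' ⊢
  linear_combination (-Complex.sin l) * e5' +
    (-2 * l * c * Complex.cosh k * Complex.sin l) * Complex.I_mul_I

theorem coeff_nonneg {k l : ℝ} (hk : 0 < k) (hl : 0 < l) : 0 ≤ coeff k l := by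
  unfold coeff
  positivity

theorem coeff_le_two_mul_div {k l : ℝ} (hk : 0 < k) (hl : 0 < l) :
    coeff k l ≤ 2 / (k ^ 2 + l ^ 2) := by
  rw [coeff, div_le_div_iff₀ (by positivity) (by positivity)]
  nlinarith [mul_nonneg (sq_nonneg (k - l)) (show 0 ≤ k ^ 2 + l ^ 2 by positivity)]

theorem coeff_le {k l : ℝ} (hk : 0 < k) (hl : 0 < l) :
    coeff k l ≤ 2 * k ^ (-(1 / 2) : ℝ) * l ^ (-(3 / 2) : ℝ) := by
  have h1 := coeff_le_two_mul_div hk hl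
  have h2 := one_div_sq_add_sq_le hk hl
  rw [show 2 / (k ^ 2 + l ^ 2) = 2 * (1 / (k ^ 2 + l ^ 2)) by ring] at h1
  rw [mul_assoc]
  linarith

theorem summable_coeff {k : ℝ} (hk : 0 < k) : Summable fun j => coeff k (freq j) :=
  Summable.of_nonneg_of_le (fun j => coeff_nonneg hk (freq_pos j))
    (fun j => coeff_le hk (freq_pos j))
    ((summable_freq_rpow (by norm_num : (1 : ℝ) < 3 / 2)).mul_left _)

/-- The odd frequencies with integer index. -/
def intFreq (n : ℤ) : ℝ := (2 * n + 1) * Real.pi / 2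

theorem intFreq_natCast (j : ℕ) : intFreq j = freq j := by
  simp [intFreq, freq]

theorem intFreq_neg (j : ℕ) : intFreq (-((j : ℤ) + 1)) = -freq j := by
  simp [intFreq, freq]
  ring

theorem cos_intFreq (n : ℤ) : Real.cos (intFreq n) = 0 := by
  rw [Real.cos_eq_zero_iff]
  exact ⟨n, rfl⟩

theorem hasSum_mode {k y : ℝ} (hk : 0 < k) (hy : |y| < 1) :
    HasSum (fun j => coeff k (freq j) * Real.sin (freq j * (y + 1))) (mode k y) := by
  have : Fact ((0 : ℝ) < 2) := ⟨two_pos⟩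
  -- The twist by `exp(-iπy/2)` shifts the integer frequencies `nπ` to the odd frequencies `nπ +
  -- π/2`. Periodicity holds because the mode vanishes at `±1`.
  set g : ℝ → ℂ := fun y => (mode k y : ℂ) * Complex.exp (-(Real.pi / 2 * y * Complex.I)) with hg
  have hgc : Continuous g := by
    have := continuous_mode k
    fun_prop
  have hg0 : g (-1) = g (-1 + 2) := by
    simp only [hg]
    rw [show (-1 : ℝ) + 2 = 1 by norm_num, mode_neg, mode_one]
    simp
  set G : C(AddCircle (2 : ℝ), ℂ) :=
    ⟨AddCircle.liftIco 2 (-1) g, AddCircle.liftIco_continuous hg0 hgc.continuousOn⟩ with hG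
  have hcoef : ∀ n : ℤ, fourierCoeff G n =
      ((1 / 2 * (coeff k (intFreq n) * Real.sin (intFreq n)) : ℝ) : ℂ) := by
    intro n
    have h1 : fourierCoeff G n = _ := fourierCoeff_liftIco_eq (T := 2) (a := -1) g n
    rw [h1, fourierCoeffOn_eq_integral]
    have h2 : ∀ y : ℝ, (fourier (T := (-1 + 2) - (-1)) (-n)) (y : AddCircle ((-1 + 2) - (-1) : ℝ)) •
        g y = (mode k y : ℂ) * Complex.exp (-(intFreq n * y * Complex.I)) := by
      intro y
      rw [fourier_coe_apply, smul_eq_mul, hg, mul_left_comm, ← Complex.exp_add]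
      congr 2
      unfold intFreq
      push_cast
      ring
    simp_rw [h2]
    rw [show (-1 : ℝ) + 2 = 1 by norm_num, integral_mode_mul_exp hk (cos_intFreq n)]
    rw [Complex.real_smul]
    push_cast
    norm_num
  have hnat : ∀ j : ℕ, fourierCoeff G (j : ℤ) =
      ((1 / 2 * (coeff k (freq j) * Real.sin (freq j)) : ℝ) : ℂ) := fun j => by
    rw [hcoef, intFreq_natCast]
  -- Indices `j` and `-(j+1)` carry opposite frequencies. Both `coeff k` and the sine are odd, so
  -- their coefficients agree and the pair combines into a cosine.
  have hneg : ∀ j : ℕ, fourierCoeff G (-((j : ℤ) + 1)) =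
      ((1 / 2 * (coeff k (freq j) * Real.sin (freq j)) : ℝ) : ℂ) := fun j => by
    rw [hcoef, intFreq_neg, Real.sin_neg, coeff, coeff, neg_sq]
    congr 1
    ring
  have hsumm : Summable fun j : ℕ =>
      ((1 / 2 * (coeff k (freq j) * Real.sin (freq j)) : ℝ) : ℂ) := by
    refine Summable.of_norm_bounded (summable_coeff hk) fun j => ?_
    rw [Complex.norm_real, Real.norm_eq_abs, abs_mul, abs_mul,
      abs_of_nonneg (coeff_nonneg hk (freq_pos j)), abs_of_pos (by norm_num : (0 : ℝ) < 1 / 2)]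
    have h1 := Real.abs_sin_le_one (freq j)
    have h2 := coeff_nonneg hk (freq_pos j)
    nlinarith
  have hs : Summable (fourierCoeff G) := by
    refine Summable.of_nat_of_neg_add_one ?_ ?_
    · simpa only [hnat] using hsumm
    · simpa only [hneg] using hsumm
  have h := has_pointwise_sum_fourier_series_of_summable hs (y : AddCircle (2 : ℝ))
  have hval : G (y : AddCircle (2 : ℝ)) = g y := by
    rw [abs_lt] at hy
    have hy' : y ∈ Set.Ico (-1 : ℝ) (-1 + 2) := by constructor <;> linarith
    exact AddCircle.liftIco_coe_apply (f := g) hy'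
  rw [hval] at h
  have h' := Complex.hasSum_re (h.nat_add_neg_add_one.mul_right
    (Complex.exp (Real.pi / 2 * y * Complex.I)))
  have e : (g y * Complex.exp (Real.pi / 2 * y * Complex.I)).re = mode k y := by
    rw [hg]
    simp only
    rw [mul_assoc, ← Complex.exp_add, neg_add_cancel, Complex.exp_zero, mul_one,
      Complex.ofReal_re]
  rw [e] at h'
  refine hasSum_of_eq h' fun j => ?_
  rw [hnat, hneg, fourier_coe_apply, fourier_coe_apply, ← smul_add, smul_mul_assoc, smul_eq_mul,
    Complex.re_ofReal_mul, add_mul, ← Complex.exp_add, ← Complex.exp_add]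
  have a1 : 2 * (Real.pi : ℂ) * Complex.I * ((j : ℤ) : ℂ) * y / (2 : ℝ) +
      Real.pi / 2 * y * Complex.I = ((freq j * y : ℝ) : ℂ) * Complex.I := by
    unfold freq
    push_cast
    ring
  have a2 : 2 * (Real.pi : ℂ) * Complex.I * ((-((j : ℤ) + 1) : ℤ) : ℂ) * y / (2 : ℝ) +
      Real.pi / 2 * y * Complex.I = ((-(freq j * y) : ℝ) : ℂ) * Complex.I := by
    unfold freq
    push_cast
    ring
  rw [a1, a2, Complex.add_re, Complex.exp_ofReal_mul_I_re, Complex.exp_ofReal_mul_I_re,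
    Real.cos_neg, mul_add, mul_one, Real.sin_add, cos_freq]
  ring

/-! ### Summation by parts and convergence over rectangles. -/

theorem abs_coeff_sub_le {k l : ℝ} (hk : 0 < k) (hl : Real.pi / 2 ≤ l) :
    |coeff k (l + Real.pi) - coeff k l| ≤ 32 * Real.pi * k * (1 / (k ^ 2 + l ^ 2)) ^ 2 := by
  have hpi := Real.pi_pos
  set c := Real.pi
  have hl0 : 0 < l := by linarith
  set P := k ^ 2 + l ^ 2 with hP
  set Q := k ^ 2 + (l + c) ^ 2 with hQ
  have hP0 : 0 < P := by positivity
  have hQP : Q - P = c * (2 * l + c) := by rw [hP, hQ]; ring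
  have hPQ : P ≤ Q := by nlinarith
  have hQ0 : 0 < Q := hP0.trans_le hPQ
  have h1 : l * (Q - P) ≤ 4 * c * P := by
    rw [hQP]
    have : l * (2 * l + c) ≤ 4 * P := by rw [hP]; nlinarith
    nlinarith
  have h2 : |(l + c) * P ^ 2 - l * Q ^ 2| ≤ 8 * c * Q ^ 2 := by
    have e : (l + c) * P ^ 2 - l * Q ^ 2 = c * P ^ 2 - l * (Q - P) * (Q + P) := by ring
    have h3 : 0 ≤ l * (Q - P) := mul_nonneg hl0.le (by linarith)
    have h4 : l * (Q - P) * (Q + P) ≤ 4 * c * P * (Q + P) := by gcongr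
    have h5 : 4 * c * P * (Q + P) ≤ 4 * c * Q * (Q + Q) := by gcongr
    have h6 : c * P ^ 2 ≤ c * Q ^ 2 := by gcongr
    have h7 : 0 ≤ c * P ^ 2 := by positivity
    have h8 : 0 ≤ c * Q ^ 2 := by positivity
    have h9 : 0 ≤ l * (Q - P) * (Q + P) := by positivity
    rw [e, abs_le]
    constructor <;> nlinarith
  have e : coeff k (l + c) - coeff k l =
      4 * k * ((l + c) * P ^ 2 - l * Q ^ 2) / (P ^ 2 * Q ^ 2) := by
    rw [coeff, coeff, ← hP, ← hQ]
    field_simp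
  rw [e, abs_div, abs_mul, abs_of_pos (by positivity : 0 < 4 * k),
    abs_of_pos (by positivity : 0 < P ^ 2 * Q ^ 2), div_le_iff₀ (by positivity)]
  calc 4 * k * |(l + c) * P ^ 2 - l * Q ^ 2| ≤ 4 * k * (8 * c * Q ^ 2) := by gcongr
    _ = 32 * c * k * (1 / P) ^ 2 * (P ^ 2 * Q ^ 2) := by field_simp; ring

/-- One factor `1/(k²+l²)` is bounded by `1/k²`, the other by `k^(-1/2) l^(-3/2)`. Differences thus
decay summably in both frequencies, which the coefficients themselves do not. -/
theorem abs_coeff_freq_sub_le {k : ℝ} (hk : 0 < k) (j : ℕ) :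
    |coeff k (freq (j + 1)) - coeff k (freq j)| ≤
      32 * Real.pi * k ^ (-(3 / 2) : ℝ) * freq j ^ (-(3 / 2) : ℝ) := by
  have e : freq (j + 1) = freq j + Real.pi := by
    simp only [freq_eq]
    push_cast
    ring
  have hj : Real.pi / 2 ≤ freq j := by
    rw [freq_eq]
    have := Real.pi_pos
    have : 0 ≤ (j : ℝ) * Real.pi := by positivity
    linarith
  have hf := freq_pos j
  rw [e]
  refine (abs_coeff_sub_le hk hj).trans ?_
  have h1 := one_div_sq_add_sq_le hk hf
  have h2 : 1 / (k ^ 2 + freq j ^ 2) ≤ 1 / k ^ 2 :=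
    one_div_le_one_div_of_le (by positivity) (by nlinarith)
  have h3 : k * (1 / k ^ 2) * k ^ (-(1 / 2) : ℝ) = k ^ (-(3 / 2) : ℝ) := by
    rw [show k * (1 / k ^ 2) = k ^ (-1 : ℝ) by rw [Real.rpow_neg_one]; field_simp,
      ← Real.rpow_add hk]
    norm_num
  have hpi := Real.pi_pos
  calc 32 * Real.pi * k * (1 / (k ^ 2 + freq j ^ 2)) ^ 2
      = 32 * Real.pi * k * ((1 / (k ^ 2 + freq j ^ 2)) * (1 / (k ^ 2 + freq j ^ 2))) := by ring
    _ ≤ 32 * Real.pi * k * ((1 / k ^ 2) *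
          (k ^ (-(1 / 2) : ℝ) * freq j ^ (-(3 / 2) : ℝ))) := by gcongr
    _ = 32 * Real.pi * (k * (1 / k ^ 2) * k ^ (-(1 / 2) : ℝ)) * freq j ^ (-(3 / 2) : ℝ) := by ring
    _ = _ := by rw [h3]

theorem coeff_le_rpow {k l : ℝ} (hk : 1 ≤ k) (hl : 0 < l) :
    coeff k l ≤ 2 * k ^ (-(3 / 2) : ℝ) := by
  have hk0 : 0 < k := by linarith
  calc coeff k l ≤ 2 / (k ^ 2 + l ^ 2) := coeff_le_two_mul_div hk0 hl
    _ ≤ 2 / k ^ 2 := by gcongr; nlinarith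
    _ = 2 * k ^ (-2 : ℝ) := by
        rw [Real.rpow_neg hk0.le, div_eq_mul_inv]
        norm_cast
    _ ≤ 2 * k ^ (-(3 / 2) : ℝ) := by
        gcongr
        norm_num

/-- Summation by parts: partial sums of `∑ coeff k (freq j) * σ j` are bounded when those of
`∑ σ j` are, with a bound that is summable over the frequencies `k`. -/
theorem abs_sum_coeff_mul_le {σ : ℕ → ℝ} {B : ℝ} (hσ : ∀ N, |∑ j ∈ Finset.range N, σ j| ≤ B)
    {k : ℝ} (hk : 1 ≤ k) (N : ℕ) :
    |∑ j ∈ Finset.range N, coeff k (freq j) * σ j| ≤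
      (2 + 32 * Real.pi * ∑' j, freq j ^ (-(3 / 2) : ℝ)) * B * k ^ (-(3 / 2) : ℝ) := by
  have hB : 0 ≤ B := (abs_nonneg _).trans (hσ 0)
  have hk0 : 0 < k := by linarith
  have hpi := Real.pi_pos
  have h := Finset.sum_range_by_parts (fun j => coeff k (freq j)) σ N
  simp only [smul_eq_mul] at h
  rw [h]
  have h1 : |coeff k (freq (N - 1)) * ∑ i ∈ Finset.range N, σ i| ≤
      2 * k ^ (-(3 / 2) : ℝ) * B := by
    rw [abs_mul, abs_of_nonneg (coeff_nonneg hk0 (freq_pos _))]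
    exact mul_le_mul (coeff_le_rpow hk (freq_pos _)) (hσ N) (abs_nonneg _) (by positivity)
  have h2 : |∑ i ∈ Finset.range (N - 1), (coeff k (freq (i + 1)) - coeff k (freq i)) *
      ∑ j ∈ Finset.range (i + 1), σ j| ≤
      32 * Real.pi * k ^ (-(3 / 2) : ℝ) * B * ∑' j, freq j ^ (-(3 / 2) : ℝ) := by
    calc _ ≤ ∑ i ∈ Finset.range (N - 1), |(coeff k (freq (i + 1)) - coeff k (freq i)) *
            ∑ j ∈ Finset.range (i + 1), σ j| := Finset.abs_sum_le_sum_abs _ _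
      _ ≤ ∑ i ∈ Finset.range (N - 1),
            32 * Real.pi * k ^ (-(3 / 2) : ℝ) * B * freq i ^ (-(3 / 2) : ℝ) := by
          refine Finset.sum_le_sum fun i _ => ?_
          rw [abs_mul]
          calc _ ≤ 32 * Real.pi * k ^ (-(3 / 2) : ℝ) * freq i ^ (-(3 / 2) : ℝ) * B :=
                mul_le_mul (abs_coeff_freq_sub_le hk0 i) (hσ _) (abs_nonneg _)
                  (by have := freq_pos i; positivity)
            _ = _ := by ring
      _ = 32 * Real.pi * k ^ (-(3 / 2) : ℝ) * B *
            ∑ i ∈ Finset.range (N - 1), freq i ^ (-(3 / 2) : ℝ) := by rw [Finset.mul_sum]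
      _ ≤ _ := by
          gcongr
          exact (summable_freq_rpow (by norm_num)).sum_le_tsum _
            fun i _ => Real.rpow_nonneg (freq_pos i).le _
  calc _ ≤ _ := abs_sub _ _
    _ ≤ _ := add_le_add h1 h2
    _ = _ := by ring

/-- Dominated convergence in the outer index: each inner sum converges, and the summation by parts
bound is uniform in the inner truncation and summable over `i`. Hence the two truncations need no
relation. -/
theorem tendsto_rectangular_sum {b σ H : ℕ → ℝ} {B l : ℝ} (hb : ∀ i, |b i| ≤ 1)
    (hσ : ∀ N, |∑ j ∈ Finset.range N, σ j| ≤ B)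
    (hH : ∀ i, HasSum (fun j => coeff (freq i) (freq j) * σ j) (H i))
    (hl : HasSum (fun i => b i * H i) l) :
    Tendsto (fun N : ℕ × ℕ => ∑ i ∈ Finset.range N.1,
      b i * ∑ j ∈ Finset.range N.2, coeff (freq i) (freq j) * σ j) atTop (𝓝 l) := by
  have hfst : Tendsto (Prod.fst : ℕ × ℕ → ℕ) atTop atTop := by
    rw [← prod_atTop_atTop_eq]
    exact tendsto_fst
  have hsnd : Tendsto (Prod.snd : ℕ × ℕ → ℕ) atTop atTop := by
    rw [← prod_atTop_atTop_eq]
    exact tendsto_snd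
  set f : ℕ × ℕ → ℕ → ℝ := fun N i => if i ∈ Finset.range N.1 then
    b i * ∑ j ∈ Finset.range N.2, coeff (freq i) (freq j) * σ j else 0 with hf
  have hsum : ∀ N, ∑' i, f N i = ∑ i ∈ Finset.range N.1,
      b i * ∑ j ∈ Finset.range N.2, coeff (freq i) (freq j) * σ j := fun N => by
    rw [tsum_eq_sum (s := Finset.range N.1) fun i hi => if_neg hi]
    exact Finset.sum_congr rfl fun i hi => if_pos hi
  rw [← hl.tsum_eq]
  simp_rw [← hsum]
  refine tendsto_tsum_of_dominated_convergence
    ((summable_freq_rpow (by norm_num : (1 : ℝ) < 3 / 2)).mul_left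
      ((2 + 32 * Real.pi * ∑' j, freq j ^ (-(3 / 2) : ℝ)) * B)) (fun i => ?_)
    (Eventually.of_forall fun N i => ?_)
  · refine (((hH i).tendsto_sum_nat.comp hsnd).const_mul (b i)).congr' ?_
    filter_upwards [hfst.eventually_gt_atTop i] with N hN
    exact (if_pos (Finset.mem_range.2 hN)).symm
  · have hbd := abs_sum_coeff_mul_le hσ (one_le_freq i) N.2
    by_cases hi : i ∈ Finset.range N.1
    · simp only [hf, if_pos hi, Real.norm_eq_abs, abs_mul]
      exact (mul_le_of_le_one_left (abs_nonneg _) (hb i)).trans hbd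
    · simp only [hf, if_neg hi, norm_zero]
      exact (abs_nonneg _).trans hbd

/-- A telescoping sum: `sin θ sin((2j+1)θ) = sin²((j+1)θ) - sin²(jθ)`. -/
theorem sin_mul_sum_sin_odd (θ : ℝ) (N : ℕ) :
    Real.sin θ * ∑ j ∈ Finset.range N, Real.sin ((2 * j + 1) * θ) = Real.sin (N * θ) ^ 2 := by
  induction N with
  | zero => simp
  | succ N ih =>
    rw [Finset.sum_range_succ, mul_add, ih]
    push_cast
    rw [show (2 * (N : ℝ) + 1) * θ = N * θ + (N + 1) * θ by ring,
      Real.sin_add, show ((N : ℝ) + 1) * θ = N * θ + θ by ring, Real.sin_add, Real.cos_add]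
    have h1 := Real.sin_sq_add_cos_sq (N * θ)
    have h2 := Real.sin_sq_add_cos_sq θ
    have h3 : Real.cos (N * θ) ^ 2 = 1 - Real.sin (N * θ) ^ 2 := by linarith
    have h4 : Real.cos θ ^ 2 = 1 - Real.sin θ ^ 2 := by linarith
    ring_nf
    simp only [h3, h4]
    ring

theorem abs_sum_sin_freq_le {y : ℝ} (hy : |y| < 1) (N : ℕ) :
    |∑ j ∈ Finset.range N, Real.sin (freq j * (y + 1))| ≤
      1 / Real.sin (Real.pi / 2 * (y + 1)) := by
  have hs := sin_pos_of_abs_lt_one hy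
  have h := sin_mul_sum_sin_odd (Real.pi / 2 * (y + 1)) N
  have e : ∀ j : ℕ, (2 * (j : ℝ) + 1) * (Real.pi / 2 * (y + 1)) = freq j * (y + 1) := fun j => by
    unfold freq
    ring
  simp_rw [e] at h
  rw [le_div_iff₀ hs, ← abs_of_pos hs, ← abs_mul, mul_comm, h,
    abs_of_nonneg (sq_nonneg _)]
  exact Real.sin_sq_le_one _

/-! ### The double series and its symmetry. -/

theorem sineTerm_eq (s : ℝ) (i j : ℕ) (p : ℝ × ℝ) : sineTerm s (2 * i + 1) (2 * j + 1) p =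
    s / 3 * (Real.sin (freq i * (p.1 + 1)) *
      (coeff (freq i) (freq j) * Real.sin (freq j * (p.2 + 1)))) := by
  have e : ∀ (j : ℕ) (t : ℝ), ((2 * j + 1 : ℕ) : ℝ) * Real.pi * (t + 1) / 2 =
      freq j * (t + 1) := fun j t => by
    unfold freq
    push_cast
    ring
  have hc : 16 * s * ((2 * i + 1 : ℕ) : ℝ) * ((2 * j + 1 : ℕ) : ℝ) / (3 * Real.pi ^ 2 *
      (((2 * i + 1 : ℕ) : ℝ) ^ 2 + ((2 * j + 1 : ℕ) : ℝ) ^ 2) ^ 2) =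
      s / 3 * coeff (freq i) (freq j) := by
    unfold coeff freq
    have hpi := Real.pi_pos
    have h : (0 : ℝ) < ((2 * i + 1 : ℕ) : ℝ) ^ 2 + ((2 * j + 1 : ℕ) : ℝ) ^ 2 := by positivity
    push_cast at h ⊢
    have e2 : ((2 * (i : ℝ) + 1) * Real.pi / 2) ^ 2 + ((2 * (j : ℝ) + 1) * Real.pi / 2) ^ 2 =
      Real.pi ^ 2 / 4 * ((2 * (i : ℝ) + 1) ^ 2 + (2 * (j : ℝ) + 1) ^ 2) := by ring
    rw [e2]
    generalize ((2 * (i : ℝ) + 1) ^ 2 + (2 * (j : ℝ) + 1) ^ 2) = D at *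
    field_simp
    ring
  rw [sineTerm, hc, e, e]
  ring

theorem sinePartialSum_eq (s : ℝ) (M N : ℕ) (p : ℝ × ℝ) : sinePartialSum s M N p =
    s / 3 * ∑ i ∈ Finset.range M, Real.sin (freq i * (p.1 + 1)) *
      ∑ j ∈ Finset.range N, coeff (freq i) (freq j) * Real.sin (freq j * (p.2 + 1)) := by
  rw [sinePartialSum]
  simp_rw [sineTerm_eq, Finset.mul_sum]

theorem hasSineSum_stripH (s : ℝ) {p : ℝ × ℝ} (hp : p ∈ square) :
    HasSineSum s p (s / 3 * stripH p) := by
  rw [HasSineSum]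
  simp_rw [sinePartialSum_eq]
  exact (tendsto_rectangular_sum (fun i => Real.abs_sin_le_one _) (abs_sum_sin_freq_le hp.2)
    (fun i => hasSum_mode (freq_pos i) hp.2) (hasSum_stripH hp.2)).const_mul _

theorem hasSineSum_swap {s a : ℝ} {p : ℝ × ℝ} (h : HasSineSum s p a) :
    HasSineSum s p.swap a := by
  rw [HasSineSum] at h ⊢
  have hswap : Tendsto (Prod.swap : ℕ × ℕ → ℕ × ℕ) atTop atTop := by
    rw [← prod_atTop_atTop_eq]
    exact tendsto_snd.prodMk tendsto_fst
  refine (h.comp hswap).congr fun N => ?_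
  simp only [Function.comp, Prod.fst_swap, Prod.snd_swap, sinePartialSum]
  rw [Finset.sum_comm]
  refine Finset.sum_congr rfl fun i _ => Finset.sum_congr rfl fun j _ => ?_
  rw [sineTerm_eq, sineTerm_eq, coeff_comm]
  simp only [Prod.fst_swap, Prod.snd_swap]
  ring

theorem swap_mem_square {p : ℝ × ℝ} : p.swap ∈ square ↔ p ∈ square := and_comm

/-- Both values are limits of the same rectangular sums with the two truncations exchanged. Nothing
in the definition of `stripH` shows this symmetry. -/
theorem stripH_swap {p : ℝ × ℝ} (hp : p ∈ square) : stripH p.swap = stripH p := by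
  have h := tendsto_nhds_unique (hasSineSum_stripH 3 (swap_mem_square.2 hp))
    (hasSineSum_swap (hasSineSum_stripH 3 hp))
  linarith

theorem hasSineSum_zero (s : ℝ) {p : ℝ × ℝ} (hp : p ∈ boundary) : HasSineSum s p 0 := by
  have h0 : ∀ M N, sinePartialSum s M N p = 0 := fun M N => by
    refine Finset.sum_eq_zero fun i _ => Finset.sum_eq_zero fun j _ => ?_
    rw [sineTerm_eq]
    obtain ⟨⟨h1, h2⟩, h3⟩ := hp
    rcases h1.lt_or_eq with h1 | h1
    · have h2' : |p.2| = 1 := le_antisymm h2 (not_lt.1 fun h => h3 ⟨h1, h⟩)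
      rw [sin_freq_mul_of_abs_eq_one j h2']
      simp
    · rw [sin_freq_mul_of_abs_eq_one i h1]
      simp
  rw [HasSineSum]
  simp only [h0]
  exact tendsto_const_nhds

/-! ### Boundedness up to the edges `y = ±1`. -/

theorem mode_eq (k y : ℝ) : mode k y =
    (Real.sinh (k * (1 - y)) + (1 - y) * Real.sinh (k * y) * Real.cosh k) / Real.cosh k ^ 2 := by
  rw [mode, mul_sub, mul_one, Real.sinh_sub]
  ring

/-- The factor `1 - y` is what compensates the geometric sum of `exp(-k(1-y))` over the frequencies,
which is of order `1/(1-y)`. -/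
theorem abs_mode_le_of_nonneg {k y : ℝ} (hk : 0 < k) (h0 : 0 ≤ y) (h1 : y ≤ 1) :
    |mode k y| ≤ 2 * Real.exp (-k) + (1 - y) * Real.exp (-(k * (1 - y))) := by
  have hc := Real.cosh_pos k
  have hs1 : 0 ≤ Real.sinh (k * (1 - y)) :=
    Real.sinh_nonneg_iff.2 (mul_nonneg hk.le (by linarith))
  have hs2 : 0 ≤ Real.sinh (k * y) := Real.sinh_nonneg_iff.2 (mul_nonneg hk.le h0)
  have hy : 0 ≤ 1 - y := by linarith
  have e1 : Real.sinh (k * (1 - y)) ≤ Real.cosh k :=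
    (Real.sinh_le_sinh.2 (by nlinarith)).trans (Real.sinh_lt_cosh k).le
  have e2 : Real.sinh (k * y) ≤ Real.exp (-(k * (1 - y))) * Real.cosh k := by
    rw [Real.sinh_eq, Real.cosh_eq, mul_div_assoc', mul_add, ← Real.exp_add, ← Real.exp_add,
      show -(k * (1 - y)) + k = k * y by ring]
    have := Real.exp_pos (-(k * y))
    have := Real.exp_pos (-(k * (1 - y)) + -k)
    linarith
  rw [mode_eq, abs_of_nonneg (by positivity), add_div]
  refine add_le_add ?_ ?_
  · refine le_trans ?_ (inv_cosh_le k)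
    rw [div_le_div_iff₀ (by positivity) hc]
    nlinarith
  · rw [div_le_iff₀ (by positivity)]
    calc (1 - y) * Real.sinh (k * y) * Real.cosh k
        ≤ (1 - y) * (Real.exp (-(k * (1 - y))) * Real.cosh k) * Real.cosh k := by gcongr
      _ = _ := by ring

theorem abs_mode_le {k y : ℝ} (hk : 0 < k) (hy : |y| ≤ 1) :
    |mode k y| ≤ 2 * Real.exp (-k) + (1 - |y|) * Real.exp (-(k * (1 - |y|))) := by
  have e : mode k y = mode k |y| := by
    rcases abs_choice y with h | h <;> rw [h]
    rw [mode_neg]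
  rw [e]
  exact abs_mode_le_of_nonneg hk (abs_nonneg y) hy

/-- From `exp(πd) ≥ 1 + πd` one gets `1 - exp(-πd) ≥ πd/(1+πd) ≥ d/2`. -/
theorem mul_inv_one_sub_exp_le {d : ℝ} (h0 : 0 < d) (h1 : d ≤ 1) :
    d * (Real.exp (-(Real.pi / 2 * d)) * (1 - Real.exp (-(Real.pi * d)))⁻¹) ≤ 2 := by
  have hpi := Real.pi_gt_three
  have hx : 0 < Real.pi * d := by positivity
  have h2 : Real.exp (-(Real.pi * d)) ≤ 1 / (1 + Real.pi * d) := by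
    rw [Real.exp_neg, ← one_div]
    exact one_div_le_one_div_of_le (by positivity) (by linarith [Real.add_one_le_exp (Real.pi * d)])
  have h3 : 1 / (1 + Real.pi * d) = 1 - Real.pi * d / (1 + Real.pi * d) := by
    field_simp
    ring
  have h4 : d / 2 ≤ Real.pi * d / (1 + Real.pi * d) := by
    rw [div_le_div_iff₀ two_pos (by positivity)]
    nlinarith [mul_pos hx h0]
  have h5 : Real.exp (-(Real.pi / 2 * d)) ≤ 1 := by
    rw [Real.exp_le_one_iff]
    have : 0 < Real.pi / 2 * d := by positivity
    linarith
  have h6 : 0 < 1 - Real.exp (-(Real.pi * d)) := by linarith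
  have h7 := Real.exp_pos (-(Real.pi / 2 * d))
  rw [← mul_assoc, ← div_eq_mul_inv, div_le_iff₀ h6]
  nlinarith

theorem abs_stripH_le {p : ℝ × ℝ} (hp : |p.2| < 1) :
    |stripH p| ≤ (∑' j, 2 * Real.exp (-freq j)) + 2 := by
  have hd : 0 < 1 - |p.2| := by linarith
  have h := (summable_exp_neg_freq.mul_left 2).hasSum.add
    ((hasSum_exp_neg_freq_mul hd).mul_left (1 - |p.2|))
  rw [← (hasSum_stripH hp).tsum_eq]
  refine (tsum_of_norm_bounded (f := fun j => Real.sin (freq j * (p.1 + 1)) *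
    mode (freq j) p.2) h fun j => ?_).trans (add_le_add le_rfl
    (mul_inv_one_sub_exp_le hd (by linarith [abs_nonneg p.2])))
  rw [Real.norm_eq_abs, abs_mul]
  exact (mul_le_of_le_one_left (abs_nonneg _) (Real.abs_sin_le_one _)).trans
    (abs_mode_le (freq_pos j) hp.le)

/-! ### The Poisson solution and its regularity. -/

/-- The solution of the Poisson problem for the correction `h` at `lam = 0`. -/
def poissonSolution (s : ℝ) : ℝ × ℝ → ℝ := Set.indicator square fun p => s / 3 * stripH p

theorem poissonSolution_of_mem (s : ℝ) {p : ℝ × ℝ} (hp : p ∈ square) :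
    poissonSolution s p = s / 3 * stripH p := Set.indicator_of_mem hp _

theorem poissonSolution_of_notMem (s : ℝ) {p : ℝ × ℝ} (hp : p ∉ square) :
    poissonSolution s p = 0 := Set.indicator_of_notMem hp _

theorem poissonSolution_swap (s : ℝ) (p : ℝ × ℝ) :
    poissonSolution s p.swap = poissonSolution s p := by
  by_cases hp : p ∈ square
  · rw [poissonSolution_of_mem s hp, poissonSolution_of_mem s (swap_mem_square.2 hp),
      stripH_swap hp]
  · rw [poissonSolution_of_notMem s hp,
      poissonSolution_of_notMem s fun h => hp (swap_mem_square.1 h)]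

theorem hasSineSum_poissonSolution (s : ℝ) {p : ℝ × ℝ} (hp : p ∈ closedSquare) :
    HasSineSum s p (poissonSolution s p) := by
  by_cases h : p ∈ square
  · rw [poissonSolution_of_mem s h]
    exact hasSineSum_stripH s h
  · rw [poissonSolution_of_notMem s h]
    exact hasSineSum_zero s ⟨hp, h⟩

theorem continuousWithinAt_poissonSolution (s : ℝ) {p : ℝ × ℝ} (hp : p ∈ closedSquare)
    (h2 : |p.2| < 1) : ContinuousWithinAt (poissonSolution s) closedSquare p := by
  have key : ∀ r ∈ closedSquare, |r.2| < 1 → poissonSolution s r = s / 3 * stripH r := by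
    intro r hr h
    by_cases h1 : |r.1| < 1
    · exact poissonSolution_of_mem s ⟨h1, h⟩
    · rw [poissonSolution_of_notMem s fun h' => h1 h'.1,
        stripH_eq_zero (le_antisymm hr.1 (not_lt.1 h1)) h, mul_zero]
  have hc : ContinuousWithinAt (fun r => s / 3 * stripH r) closedSquare p :=
    (continuousAt_const.mul (contDiffOn_stripH.continuousOn.continuousAt
      (isOpen_horizontal_strip.mem_nhds h2))).continuousWithinAt
  refine hc.congr_of_eventuallyEq ?_ (key p hp h2)
  filter_upwards [self_mem_nhdsWithin,
    mem_nhdsWithin_of_mem_nhds (isOpen_horizontal_strip.mem_nhds h2)] with r hr hr2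
  exact key r hr hr2

theorem isRegular_poissonSolution (s : ℝ) : IsRegular (poissonSolution s) := by
  refine ⟨?_, fun p hp => ?_, |s / 3| * ((∑' j, 2 * Real.exp (-freq j)) + 2), fun p hp => ?_⟩
  · exact (contDiffOn_const.mul (contDiffOn_stripH.mono square_subset_horizontal_strip)).congr
      fun p hp => poissonSolution_of_mem s hp
  · refine ContinuousWithinAt.mono ?_ Set.sdiff_subset
    by_cases h2 : |p.2| < 1
    · exact continuousWithinAt_poissonSolution s hp.1 h2
    · have h1 : |p.1| < 1 := lt_of_le_of_ne hp.1.1 fun h1 =>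
        hp.2 ⟨h1, le_antisymm hp.1.2 (not_lt.1 h2)⟩
      -- Near an edge `y = ±1` the swapped point lies near `x = ±1`, inside the strip, where
      -- continuity is already known.
      have hc := (continuousWithinAt_poissonSolution s (p := p.swap) ⟨hp.1.2, hp.1.1⟩ h1).comp
        (f := Prod.swap) (s := closedSquare) (x := p) continuous_swap.continuousWithinAt
        fun r hr => ⟨hr.2, hr.1⟩
      exact hc.congr (fun r _ => (poissonSolution_swap s r).symm) (poissonSolution_swap s p).symm
  · by_cases h : p ∈ square
    · rw [poissonSolution_of_mem s h, abs_mul]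
      gcongr
      exact abs_stripH_le h.2
    · rw [poissonSolution_of_notMem s h, abs_zero]
      have : 0 ≤ ∑' j, 2 * Real.exp (-freq j) := tsum_nonneg fun j => by positivity
      positivity

theorem solvesPoisson_poissonSolution {s : ℝ} {q : ℝ × ℝ → ℝ}
    (hq : Set.EqOn q (harmonicProfile s) square) : SolvesPoisson q (poissonSolution s) := by
  refine ⟨isRegular_poissonSolution s, fun p hp => ?_, fun p hp =>
    poissonSolution_of_notMem s hp.2⟩
  have hH := contDiffOn_stripH.mono square_subset_horizontal_strip
  have h := lap_add_const_mul (s / 3) 0 hH hH hp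
  simp only [zero_mul, add_zero] at h
  rw [lap_congr (fun r hr => poissonSolution_of_mem s hr) hp, h, lap_stripH hp,
    dxx_congr hq hp, dyy_congr hq hp, dxx_harmonicProfile s hp, dyy_harmonicProfile s hp]
  ring

/-! ### Characterisation of the corrections on the closed square. -/

theorem eqOn_closedSquare {u v : ℝ × ℝ → ℝ} (h : Set.EqOn u v square)
    (hb : ∀ p ∈ boundary, u p = v p) : Set.EqOn u v closedSquare := fun p hp => by
  by_cases hs : p ∈ square
  · exact h hs
  · exact hb p ⟨hp, hs⟩

theorem solvesPoisson_iff {q h₀ h : ℝ × ℝ → ℝ} (h0 : SolvesPoisson q h₀) :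
    SolvesPoisson q h ↔ Set.EqOn h h₀ closedSquare := by
  refine ⟨fun hh => ?_, fun e => ⟨h0.regular.congr e, fun p hp => ?_, fun p hp => ?_⟩⟩
  · refine eqOn_closedSquare (eqOn_square_of_lap_eq hh.regular h0.regular (fun p hp => ?_)
      fun p hp => ?_) fun p hp => ?_
    · rw [hh.pde p hp, h0.pde p hp]
    · rw [hh.zero p hp.1, h0.zero p hp.1]
    · rw [hh.zero p hp, h0.zero p hp]
  · rw [lap_congr (e.mono square_subset_closedSquare) hp, h0.pde p hp]
  · rw [e hp.1, h0.zero p hp]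

theorem eqOn_zero_iff {u : ℝ × ℝ → ℝ} :
    (IsRegular u ∧ (∀ p ∈ square, lap u p = 0) ∧ ∀ p ∈ boundary, u p = 0) ↔
      Set.EqOn u 0 closedSquare := by
  refine ⟨fun ⟨h1, h2, h3⟩ => ?_, fun e => ⟨(isRegular_const 0).congr e, fun p hp => ?_,
    fun p hp => e hp.1⟩⟩
  · refine eqOn_closedSquare (eqOn_square_of_lap_eq h1 (isRegular_const 0) (fun p hp => ?_)
      fun p hp => h3 p hp.1) h3
    exact (h2 p hp).trans (lap_const 0 p).symm
  · rw [lap_congr (v := fun _ => 0) (e.mono square_subset_closedSquare) hp, lap_const]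

theorem isFirstOrderCorrection_iff {B C L : ℝ} {q f g h : ℝ × ℝ → ℝ} :
    IsFirstOrderCorrection B C L 0 q f g h ↔
      Set.EqOn f 0 closedSquare ∧ Set.EqOn g 0 closedSquare ∧ SolvesPoisson q h := by
  rw [← eqOn_zero_iff, ← eqOn_zero_iff]
  constructor
  · intro H
    exact ⟨⟨H.regular_f, fun p hp => by simpa using H.pde_f p hp, H.zero_f⟩,
      ⟨H.regular_g, fun p hp => by simpa using H.pde_g p hp, H.zero_g⟩,
      H.regular_h, fun p hp => by rw [H.pde_h p hp]; ring, H.zero_h⟩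
  · rintro ⟨⟨f1, f2, f3⟩, ⟨g1, g2, g3⟩, H⟩
    exact ⟨f1, g1, H.regular, fun p hp => by simpa using f2 p hp,
      fun p hp => by simpa using g2 p hp, fun p hp => by rw [H.pde p hp]; ring, f3, g3, H.zero⟩

/-! ### The lower bound at the centre. -/

theorem exp_neg_half_pi_bounds :
    0.135 ≤ Real.exp (-(Real.pi / 2)) ∧ Real.exp (-(Real.pi / 2)) ≤ 0.23 := by
  have h1 := Real.exp_one_gt_d9
  have h2 := Real.exp_one_lt_d9
  have h3 := Real.pi_gt_three
  have h4 := Real.pi_lt_four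
  have hpos := Real.exp_pos (-(Real.pi / 2))
  constructor
  · have e1 : Real.exp (-2) ≤ Real.exp (-(Real.pi / 2)) := Real.exp_le_exp.2 (by linarith)
    have e2 : Real.exp (-2) * (Real.exp 1) ^ 2 = 1 := by
      rw [← Real.exp_nat_mul, ← Real.exp_add]
      norm_num
    have e3 : Real.exp 1 ^ 2 ≤ 7.39 := by nlinarith
    nlinarith [Real.exp_pos (-2)]
  · have e1 : Real.exp (-(Real.pi / 2)) ^ 2 ≤ Real.exp (-3) := by
      rw [← Real.exp_nat_mul]
      exact Real.exp_le_exp.2 (by push_cast; linarith)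
    have e2 : Real.exp (-3) * (Real.exp 1) ^ 3 = 1 := by
      rw [← Real.exp_nat_mul, ← Real.exp_add]
      norm_num
    have e3 : (20 : ℝ) ≤ Real.exp 1 ^ 3 :=
      le_trans (by norm_num) (pow_le_pow_left₀ (by norm_num) h1.le 3)
    have e4 : Real.exp (-3) ≤ 0.05 := by nlinarith [Real.exp_pos (-3)]
    nlinarith

theorem mode_zero (j : ℕ) : mode (freq j) 0 = coeffH j := by
  simp [mode, coeffH]

/-- The value at the centre, bounded below by the first term of the series minus a geometric
bound for the rest. -/
theorem one_sixth_le_stripH_zero : 1 / 6 ≤ stripH (0, 0) := by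
  obtain ⟨ht1, ht2⟩ := exp_neg_half_pi_bounds
  set t := Real.exp (-(Real.pi / 2)) with ht
  have ht0 : 0 < t := Real.exp_pos _
  have hsq : Real.exp (-Real.pi) = t ^ 2 := by
    rw [ht, ← Real.exp_nat_mul]
    push_cast
    ring_nf
  have hf0 : freq 0 = Real.pi / 2 := by simp [freq]
  -- The first term is split off from the series and from its majorant `4 exp(-freq j)`, which turns
  -- the tail estimate into a bound on `stripH (0, 0)` minus that term.
  have h := (hasSum_nat_add_iff' 1).2 (hasSum_stripH (p := (0, 0)) (by simp))
  have hg := (hasSum_nat_add_iff' 1).2 ((hasSum_exp_neg_freq_mul one_pos).mul_left 4)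
  simp only [Finset.sum_range_one, hf0, mul_one, hsq, ← ht] at hg
  have hle := tsum_of_norm_bounded hg (f := fun j => Real.sin (freq (j + 1) * ((0 : ℝ) + 1)) *
    mode (freq (j + 1)) 0) fun j => by
      rw [norm_mul, mode_zero]
      exact (mul_le_of_le_one_left (norm_nonneg _) (Real.abs_sin_le_one _)).trans
        (abs_coeffH_le (j + 1))
  rw [h.tsum_eq, Finset.sum_range_one, mode_zero, coeffH, hf0, zero_add, mul_one,
    Real.sin_pi_div_two, one_mul, Real.norm_eq_abs] at hle
  have hle' := (abs_le.1 hle).1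
  have hexp : Real.exp (Real.pi / 2) = 1 / t := by
    rw [ht, Real.exp_neg, one_div, inv_inv]
  -- In terms of `t = exp(-π/2)` the first term is `2t(1-t²)/(1+t²)²` and the tail is at most
  -- `4t³/(1-t²)`. The bounds `0.23` and `0.06` leave `0.17 > 1/6`.
  have hfirst : 0.23 ≤ Real.sinh (Real.pi / 2) / Real.cosh (Real.pi / 2) ^ 2 := by
    rw [le_div_iff₀ (by have := Real.cosh_pos (Real.pi / 2); positivity), Real.sinh_eq,
      Real.cosh_eq, hexp, ← ht]
    have e : ((1 / t + t) / 2) ^ 2 = (1 + t ^ 2) ^ 2 / (4 * t ^ 2) := by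
      field_simp
      ring
    have e' : (1 / t - t) / 2 = 2 * t * (1 - t ^ 2) / (4 * t ^ 2) := by
      field_simp
      ring
    rw [e, e', mul_div_assoc']
    gcongr ?_ / _
    have h2 : t ^ 2 ≤ 0.0529 := by nlinarith
    have h3 : (1 + t ^ 2) ^ 2 ≤ 1.0529 ^ 2 := by gcongr; linarith
    have h4 : 2 * 0.135 * (1 - 0.0529) ≤ 2 * t * (1 - t ^ 2) := by
      gcongr
    norm_num at h3 h4 ⊢
    linarith
  have htail : 4 * (t * (1 - t ^ 2)⁻¹) - 4 * t ≤ 0.06 := by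
    have h2 : t ^ 2 ≤ 0.0529 := by nlinarith
    have h3 : 0 < 1 - t ^ 2 := by linarith
    have e : 4 * (t * (1 - t ^ 2)⁻¹) - 4 * t = 4 * t * t ^ 2 / (1 - t ^ 2) := by
      field_simp
      ring
    rw [e, div_le_iff₀ h3]
    have h4 : 4 * t * t ^ 2 ≤ 4 * 0.23 * 0.0529 := by gcongr
    norm_num at h4 h2 ⊢
    linarith
  norm_num at hfirst htail ⊢
  linarith

theorem sStar_pos {B C : ℝ} (hB : 0 < B) (hC : 0 < C) : 0 < sStar B C := by
  unfold sStar sPlus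
  positivity

end NematicSquare

end

theorem proposition4p1 (B C L : ℝ) (hB : 0 < B) (hC : 0 < C) (hL : 0 < L) :
    (∃ q₀ : ℝ × ℝ → ℝ, NematicSquare.IsLeadingOrder B C L 0 q₀) ∧
    ∀ q₀ : ℝ × ℝ → ℝ, NematicSquare.IsLeadingOrder B C L 0 q₀ →
      ∃ h₀ : ℝ × ℝ → ℝ,
        (∀ p ∈ NematicSquare.closedSquare,
          NematicSquare.HasSineSum (NematicSquare.sStar B C) p (h₀ p)) ∧
        (∀ f g h : ℝ × ℝ → ℝ, NematicSquare.IsFirstOrderCorrection B C L 0 q₀ f g h ↔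
          Set.EqOn f 0 NematicSquare.closedSquare ∧ Set.EqOn g 0 NematicSquare.closedSquare ∧
            Set.EqOn h h₀ NematicSquare.closedSquare) ∧
        (∀ h : ℝ × ℝ → ℝ, NematicSquare.SolvesPoisson q₀ h ↔
          Set.EqOn h h₀ NematicSquare.closedSquare) ∧
        NematicSquare.sStar B C / 6 - NematicSquare.sStar B C / 9 ≤ h₀ (0, 0) ∧
        0 < NematicSquare.sStar B C / 6 - NematicSquare.sStar B C / 9 ∧
        (∀ L₂ : ℝ, 0 < L₂ →
          -NematicSquare.sStar B C / 6 < -NematicSquare.sStar B C / 6 + L₂ * h₀ (0, 0)) := by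
  have hs := NematicSquare.sStar_pos hB hC
  refine ⟨⟨_, NematicSquare.isLeadingOrder_harmonicProfile B C L⟩, fun q₀ hq =>
    ⟨NematicSquare.poissonSolution (NematicSquare.sStar B C), ?_⟩⟩
  have hsol := NematicSquare.solvesPoisson_poissonSolution hq.eqOn_harmonicProfile
  have hzero : NematicSquare.poissonSolution (NematicSquare.sStar B C) (0, 0) =
      NematicSquare.sStar B C / 3 * NematicSquare.stripH (0, 0) :=
    NematicSquare.poissonSolution_of_mem _ (by simp [NematicSquare.square])
  have hge : NematicSquare.sStar B C / 6 - NematicSquare.sStar B C / 9 ≤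
      NematicSquare.poissonSolution (NematicSquare.sStar B C) (0, 0) := by
    rw [hzero]
    -- The target `s/6 - s/9` equals `s/18 = (s/3)(1/6)`.
    nlinarith [NematicSquare.one_sixth_le_stripH_zero]
  have hpos : 0 < NematicSquare.sStar B C / 6 - NematicSquare.sStar B C / 9 := by linarith
  refine ⟨fun p hp => NematicSquare.hasSineSum_poissonSolution _ hp, fun f g h => ?_,
    fun h => NematicSquare.solvesPoisson_iff hsol, hge, hpos, fun L₂ hL₂ => ?_⟩
  · rw [NematicSquare.isFirstOrderCorrection_iff, NematicSquare.solvesPoisson_iff hsol]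
  · have := mul_pos hL₂ (hpos.trans_le hge)
    linarith
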